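/- **Protocol.** Bit strings are vectors over $\mathbf F_2$, $|\cdot|$ is Hamming weight and $d_H$ Hamming distance. The protocol BB84-INFO-$z$ has public parameters $n,n_z,n_x\ge 1$ (put $N=n+n_z+n_x$), thresholds $p_{a,z},p_{a,x}>0$, an $r\times n$ parity-check matrix $P_C$ and an $m\times n$ matrix $P_K$ over $\mathbf F_2$ ($m\ge 1$) whose rows $v_1,\dots,v_r$ and $v_{r+1},\dots,v_{r+m}$ are together linearly independent, and a decoding function $D:\mathbf F_2^n\times\mathbf F_2^r\to\mathbf F_2^n$. Let $V_l=\operatorname{Span}\{v_1,\dots,v_l\}$ and $d_{r,m}=\min_{r\le l<r+m}d_H(v_{l+1},V_l)$. Alice chooses uniformly at random a partition $\mathcal P=(\mathbf s,\mathbf z,\mathbf b)$ of the $N$ positions (strings in $\mathbf F_2^N$ with $|\mathbf s|=n$, $|\mathbf z|=n_z$, $|\mathbf b|=n_x$, $|\mathbf s+\mathbf z+\mathbf b|=N$) and, independently, a uniform $\mathbf i\in\mathbf F_2^N$, and sends the qubits $|i_j^{b_j}\rangle$, where $|0^0\rangle,|1^0\rangle$ is the computational ($z$) basis and $|0^1\rangle,|1^1\rangle=(|0^0\rangle\pm|1^0\rangle)/\sqrt2$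 the $x$ basis. In a *collective attack*, chosen in advance, Eve attaches to each qubit $j$ a separate (finite-dimensional) probe in a fixed unit vector and applies a unitary $U_j$ to probe and qubit; she keeps the probe and forwards the qubit. Bob measures qubit $j$ in the basis $b_j$, obtaining $\mathbf i^B$. Let $\mathbf c=\mathbf i+\mathbf i^B$, and let a subscript $\mathbf s,\mathbf z,\mathbf b$ denote the substring on the positions where that string is $1$. The test is passed ($\mathbf T=1$) if $|\mathbf c_{\mathbf z}|/n_z\le p_{a,z}$ and $|\mathbf c_{\mathbf b}|/n_x\le p_{a,x}$; otherwise the protocol aborts. With $\mathbf x=\mathbf i_{\mathbf s}$ and $\mathbf x^B=\mathbf i^B_{\mathbf s}$, Alice announces $\boldsymbol\xi=\mathbf xP_C^{T}$; her final key is $\mathbf k=\mathbf xP_K^{T}$, and Bob's is $\mathbf k'=D(\mathbf x^B,\boldsymbol\xi)P_K^{T}$. Put $$\rho_{ABE}=\sum_{\mathbf i,\mathbf i^B,\mathcal P\,:\,\mathbf T=1}P(\mathbf i,\mathbf i^B,\mathcal P)\;|\mathbf k\rangle\langle\mathbf k|_A\otimes|\mathbf k'\rangle\langle\mathbf k'|_B\otimes\rho^{E}_{\mathbf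 i,\mathbf i^B,\mathcal P}\otimes|\mathbf w\rangle\langle\mathbf w|,$$ where $\rho^E_{\mathbf i,\mathbf i^B,\mathcal P}$ is the state of Eve's probes given $\mathbf i,\mathbf i^B,\mathcal P$, and $\mathbf w=(\mathbf i_{\mathbf z},\mathbf i_{\mathbf b},\mathbf i^B_{\mathbf z},\mathbf i^B_{\mathbf b},\mathcal P,\boldsymbol\xi)$ is the published information (both of these belong to Eve's system). Put $\rho_U=2^{-m}\sum_{\mathbf k}|\mathbf k\rangle\langle\mathbf k|_A\otimes|\mathbf k\rangle\langle\mathbf k|_B$ and $\rho_E=\operatorname{tr}_{AB}\rho_{ABE}$. **Theorem.** Let $\delta,R>0$, and let there be given, for every $n$ in a set $S$ of positive integers (for instance, an infinite one), matrices $P_C$ ($r_n\times n$) and $P_K$ ($m_n\times n$) as above, with $\delta<d_{r_n,m_n}/n$ and $m_n/n\le R$. Let $p_{a,z},p_{a,x},\epsilon_{\rm sec},\epsilon_{\rm rel}>0$ with $p_{a,x}+\epsilon_{\rm sec}\le\delta/2$. Suppose that for every $n\in S$ the code can correct $n(p_{a,z}+\epsilon_{\rm rel})$ errors: $D(\mathbf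 x^B,\mathbf xP_C^{T})=\mathbf x$ whenever $d_H(\mathbf x,\mathbf x^B)\le n(p_{a,z}+\epsilon_{\rm rel})$. Then: 1. For every $n\in S$, all $n_z,n_x\ge1$ and every collective attack, $$\tfrac12\operatorname{tr}\left|\rho_{ABE}-\rho_U\otimes\rho_E\right|\le e^{-2\left(\frac{n_z}{n+n_z}\right)^2n\epsilon_{\rm rel}^2}+2R\,n\,e^{-\left(\frac{n_x}{n+n_x}\right)^2n\epsilon_{\rm sec}^2}.$$ 2. This bound is exponentially small in $n$ when the numbers of test bits are at least proportional to $n$, so the protocol is composably secure: for every $c>0$ there are $C,\kappa>0$ such that the right-hand side is at most $Ce^{-\kappa n}$ for all $n,n_z,n_x\ge1$ with $n_z,n_x\ge cn$; hence, for $n\in S$ and such $n_z,n_x$, $\tfrac12\operatorname{tr}|\rho_{ABE}-\rho_U\otimes\rho_E|\le Ce^{-\kappa n}$ for every collective attack. -/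

import Mathlib

open scoped Kronecker MatrixOrder Matrix

noncomputable section

namespace BB84InfoZ

/-! ### Bit strings, codes and partitions -/

/-- Bit strings of length `t`, i.e. the vector space `F_2^t`. -/
abbrev Bits (t : ℕ) : Type := Fin t → ZMod 2

/-- The public coding data for `n` INFO bits: the parity-check matrix `PC` (with `r` rows), the
privacy-amplification matrix `PK` (with `m` rows), and the procedure `dec` by which Bob turns his
INFO string and the syndrome announced by Alice into an estimate of Alice's INFO string. -/
structure Code (n : ℕ) where
  r : ℕ
  m : ℕ
  PC : Matrix (Fin r) (Fin n) (ZMod 2)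
  PK : Matrix (Fin m) (Fin n) (ZMod 2)
  dec : Bits n → Bits r → Bits n

namespace Code

variable {n : ℕ} (K : Code n)

/-- The rows `v_1, …, v_r` of `PC` followed by the rows `v_{r+1}, …, v_{r+m}` of `PK`
(indexed from `0`). -/
def rows : Fin (K.r + K.m) → Bits n :=
  Fin.append (fun a => K.PC a) (fun a => K.PK a)

/-- The span of the first `l` rows. -/
def rowSpan (l : ℕ) : Submodule (ZMod 2) (Bits n) :=
  Submodule.span (ZMod 2) (K.rows '' {a | (a : ℕ) < l})

/-- `d_{r,m}`: the minimum over the rows of `PK` of the Hamming distance between that row and the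
span of all the rows preceding it. (For `m = 0` the minimum is over the empty set; the value is
then `0`.) -/
def dist : ℕ :=
  sInf {d : ℕ | ∃ l : Fin (K.r + K.m), K.r ≤ (l : ℕ) ∧
    ∃ w ∈ K.rowSpan l, d = hammingDist (K.rows l) w}

/-- The syndrome `ξ = x PCᵀ`. -/
def syndrome (x : Bits n) : Bits K.r := x ᵥ* K.PCᵀ

/-- The key-generation function `k = x PKᵀ`. -/
def key (x : Bits n) : Bits K.m := x ᵥ* K.PKᵀ

/-- Bob's final key, computed from his INFO string and Alice's syndrome. -/
def bobKey (xB : Bits n) (ξ : Bits K.r) : Bits K.m := K.key (K.dec xB ξ)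

/-- Error correction recovers Alice's string whenever there are at most `t` errors. -/
def CorrectsErrors (t : ℝ) : Prop :=
  ∀ x xB : Bits n, (hammingDist x xB : ℝ) ≤ t → K.dec xB (K.syndrome x) = x

end Code

/-- The partitions `(s, z, b)` of the `N = n + nz + nx` positions into `n` INFO, `nz` TEST-Z and
`nx` TEST-X positions, given by three `N`-bit strings. -/
abbrev Partition (n nz nx : ℕ) : Type :=
  {P : Bits (n + nz + nx) × Bits (n + nz + nx) × Bits (n + nz + nx) //
    hammingNorm P.1 = n ∧ hammingNorm P.2.1 = nz ∧ hammingNorm P.2.2 = nx ∧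
      hammingNorm (P.1 + P.2.1 + P.2.2) = n + nz + nx}

instance (n nz nx : ℕ) : DecidableEq (Partition n nz nx) := inferInstance

/-- The substring of `i` on the positions where `s` is `1`, in increasing order. -/
def substring {N k : ℕ} (s : Bits N) (hs : hammingNorm s = k) (i : Bits N) : Bits k :=
  fun a => i ((Finset.univ.filter fun j => s j ≠ 0).orderEmbOfFin hs a)

namespace Partition

variable {n nz nx : ℕ} (P : Partition n nz nx)

/-- The string `b` of bases: `0` for the `z` basis, `1` for the `x` basis. -/
def bases : Bits (n + nz + nx) := P.1.2.2

/-- The INFO substring. -/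
def info (i : Bits (n + nz + nx)) : Bits n := substring P.1.1 P.2.1 i

/-- The TEST-Z substring. -/
def testZ (i : Bits (n + nz + nx)) : Bits nz := substring P.1.2.1 P.2.2.1 i

/-- The TEST-X substring. -/
def testX (i : Bits (n + nz + nx)) : Bits nx := substring P.1.2.2 P.2.2.2.1 i

/-- The test `T = 1`: the error rates on the TEST-Z and TEST-X bits do not exceed `pz`, `px`. -/
def TestPassed (pz px : ℝ) (i iB : Bits (n + nz + nx)) : Prop :=
  (hammingNorm (P.testZ (i + iB)) : ℝ) / nz ≤ pz ∧
    (hammingNorm (P.testX (i + iB)) : ℝ) / nx ≤ px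

end Partition

/-! ### Qubits and collective attacks -/

/-- Coordinates, in the computational basis, of the qubit state `|i^b⟩`: the `z` basis for `b = 0`
and the `x` basis `(|0⟩ ± |1⟩)/√2` for `b = 1`. -/
def ket (b i : ZMod 2) : ZMod 2 → ℂ := fun t =>
  if b = 0 then (if t = i then 1 else 0)
  else (if i = 1 ∧ t = 1 then -1 else 1) / (Real.sqrt 2 : ℂ)

/-- A collective attack on `N` qubits: for each qubit `j` a probe with state space `ℂ^(dim j)`,
its initial unit vector, and a unitary operator on the probe together with the qubit. -/
structure CollectiveAttack (N : ℕ) where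
  dim : Fin N → ℕ
  init : ∀ j, Fin (dim j) → ℂ
  init_unit : ∀ j, ∑ e, ‖init j e‖ ^ 2 = 1
  U : ∀ j, Matrix.unitaryGroup (Fin (dim j) × ZMod 2) ℂ

namespace CollectiveAttack

variable {N : ℕ} (𝒜 : CollectiveAttack N)

/-- Basis labels of the joint system of all the probes. -/
abbrev Probe : Type := ∀ j, Fin (𝒜.dim j)

/-- The joint state `U_j |0^E⟩|i^b⟩` of the `j`-th probe and the `j`-th qubit after the attack. -/
def afterAttack (j : Fin N) (b i : ZMod 2) : Fin (𝒜.dim j) × ZMod 2 → ℂ :=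
  (𝒜.U j : Matrix (Fin (𝒜.dim j) × ZMod 2) (Fin (𝒜.dim j) × ZMod 2) ℂ) *ᵥ
    fun et => 𝒜.init j et.1 * ket b i et.2

/-- The non-normalized probe vector `|E^b_{i,i'}⟩ = (1 ⊗ ⟨i'^b|) U_j |0^E⟩|i^b⟩`. -/
def probeVec (j : Fin N) (b i i' : ZMod 2) : Fin (𝒜.dim j) → ℂ :=
  fun e => ∑ t, star (ket b i' t) * 𝒜.afterAttack j b i (e, t)

/-- The non-normalized joint vector `⨂_j |E^{b_j}_{i_j, iB_j}⟩` of all the probes when Alice sends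
`i` in the bases `b` and Bob measures `iB` in the same bases. -/
def eveVec (b i iB : Bits N) : 𝒜.Probe → ℂ :=
  fun e => ∏ j, 𝒜.probeVec j (b j) (i j) (iB j) (e j)

/-- The probability that Bob measures `iB` when Alice sends `i`, both using the bases `b`. -/
def outcomeProb (b i iB : Bits N) : ℝ := ∑ e, ‖𝒜.eveVec b i iB e‖ ^ 2

/-- Eve's normalized state when Alice sends `i` and Bob measures `iB`, both using the bases `b`.
(It is `0` in the case of an outcome of probability `0`.) -/
def eveState (b i iB : Bits N) : Matrix 𝒜.Probe 𝒜.Probe ℂ :=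
  ((𝒜.outcomeProb b i iB)⁻¹ : ℂ) •
    Matrix.vecMulVec (𝒜.eveVec b i iB) (star (𝒜.eveVec b i iB))

end CollectiveAttack

/-! ### The final state of the protocol -/

/-- The projector `|a⟩⟨a|` onto a basis state. -/
def proj {α : Type*} [DecidableEq α] (a : α) : Matrix α α ℂ := Matrix.single a a 1

/-- The partial trace over the first subsystem. -/
def partialTraceLeft {α β : Type*} [Fintype α] (M : Matrix (α × β) (α × β) ℂ) : Matrix β β ℂ :=
  fun e e' => ∑ a, M (a, e) (a, e')

/-- The trace distance `½ tr |M - M'|`, where `|A| = √(A† A)`. -/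
def traceDist {α : Type*} [Fintype α] [DecidableEq α] (M M' : Matrix α α ℂ) : ℝ :=
  (1 / 2) * (Matrix.trace (CFC.abs (M - M'))).re

section State

variable {n : ℕ} (K : Code n) (nz nx : ℕ) (pz px : ℝ) (𝒜 : CollectiveAttack (n + nz + nx))

/-- What is published on the classical channel: Alice's TEST-Z and TEST-X bits, Bob's TEST-Z and
TEST-X bits, the partition, and the syndrome. -/
abbrev Public : Type :=
  (Bits nz × Bits nx × Bits nz × Bits nx) × Partition n nz nx × Bits K.r

instance : DecidableEq (Public K nz nx) :=
  have : DecidableEq (Bits nz × Bits nx × Bits nz × Bits nx) := inferInstance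
  have : DecidableEq (Partition n nz nx × Bits K.r) := inferInstance
  instDecidableEqProd

/-- The published information in a given run. -/
def published (P : Partition n nz nx) (i iB : Bits (n + nz + nx)) : Public K nz nx :=
  ((P.testZ i, P.testX i, P.testZ iB, P.testX iB), P, K.syndrome (P.info i))

/-- `P(i, iB, 𝒫)`: the partition and the string `i` are uniform and independent, and `iB` is the
outcome of Bob's measurement. -/
def jointProb (i iB : Bits (n + nz + nx)) (P : Partition n nz nx) : ℝ :=
  (1 / (Fintype.card (Partition n nz nx) : ℝ)) * (1 / 2 ^ (n + nz + nx)) *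
    𝒜.outcomeProb P.bases i iB

open scoped Classical in
/-- The final (sub-normalized) state `ρ_ABE`: the sum over all runs in which the test is passed.
Systems `A`, `B` hold the final keys; `E` consists of the probes and the published information. -/
def rhoABE : Matrix ((Bits K.m × Bits K.m) × (𝒜.Probe × Public K nz nx))
    ((Bits K.m × Bits K.m) × (𝒜.Probe × Public K nz nx)) ℂ :=
  ∑ P : Partition n nz nx, ∑ i : Bits (n + nz + nx), ∑ iB : Bits (n + nz + nx),
    if P.TestPassed pz px i iB then
      (jointProb nz nx 𝒜 i iB P : ℂ) •
        ((proj (K.key (P.info i)) ⊗ₖ proj (K.bobKey (P.info iB) (K.syndrome (P.info i)))) ⊗ₖ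
          (𝒜.eveState P.bases i iB ⊗ₖ proj (published K nz nx P i iB)))
    else 0

/-- `ρ_U`: the uniform mixture of all the pairs of identical keys. -/
def rhoU : Matrix (Bits K.m × Bits K.m) (Bits K.m × Bits K.m) ℂ :=
  (1 / 2 ^ K.m : ℂ) • ∑ k : Bits K.m, proj k ⊗ₖ proj k

/-- `ρ_E = tr_AB ρ_ABE`. -/
def rhoE : Matrix (𝒜.Probe × Public K nz nx) (𝒜.Probe × Public K nz nx) ℂ :=
  partialTraceLeft (rhoABE K nz nx pz px 𝒜)

/-- `½ tr |ρ_ABE - ρ_U ⊗ ρ_E|`. -/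
def distanceFromIdeal : ℝ :=
  traceDist (rhoABE K nz nx pz px 𝒜) (rhoU K ⊗ₖ rhoE K nz nx pz px 𝒜)

end State

end BB84InfoZ

end

/-! For a Hermitian `A` with sign `S`, a unitary, one has `tr |A| = tr (S A)`, which turns the
distance into a sum over runs of the protocol. Each run contributes a rank one operator, whose
pairing with `S` is a form `⟨E|B|E⟩`: here `E` is Eve's unnormalized vector and `B` the diagonal
block of `S` at the classical data of the run, a contraction. For the real state the block is taken
at the actual pair of keys; for the ideal state it is averaged over all pairs of equal keys. Passing
between them through the pair formed by two copies of Alice's key separates reliability from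
secrecy.

Reliability (`sum_keys_ne_le`). The keys can differ only if there are more than `n (pz + εrel)` INFO
errors. Once the TEST-X positions are fixed, INFO and TEST-Z qubits are all handled in the `z`
basis, so their errors do not depend on how they are split. A low TEST-Z rate together with a high
INFO rate is then a deviation in sampling without replacement, bounded by `card_bad_samples_le`.

Secrecy (`norm_sum_runs_keyDefect_le`). For a fixed error string `c` on the INFO bits, expand `x ↦ E
x (x + c)` in characters of `F_2^n`. A product of two characters of weight below `d / 2`, where `d =
d_{r,m}`, is a character `u` of weight below `d`. Either `u` lies in the span of the rows of `PC`
and sees only the syndrome, or it lies outside the span of all rows and cancels on the strings with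
given syndrome and key. In both cases it cannot distinguish the key from a uniform one
(`Code.sum_sgn_mul_key_sub_average`), so only Fourier weight at `|a| ≥ d / 2` matters. By
complementarity (`CollectiveAttack.errX_eq`, `sum_nsq_fourier_eveVec`) the weight at `a` is the
probability of the error string `a` had the INFO qubits been sent and measured in the `x` basis. For
a collective attack these hypothetical errors are independent of the partition, and sampling against
TEST-X bounds the event that the test passes with at least `d / 2` of them. Cauchy–Schwarz puts this
probability under a square root, which halves the exponent. -/

open scoped Kronecker MatrixOrder Matrix

noncomputable section

namespace BB84InfoZ

/-! ### The trace norm of a Hermitian matrix -/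

/-- The squared Euclidean norm of a complex vector. -/
def nsq {α : Type*} [Fintype α] (v : α → ℂ) : ℝ := ∑ a, ‖v a‖ ^ 2

section
variable {α : Type*} [Fintype α]

theorem nsq_nonneg (v : α → ℂ) : 0 ≤ nsq v := Finset.sum_nonneg fun _ _ => by positivity

theorem star_dotProduct_self (v : α → ℂ) : star v ⬝ᵥ v = (nsq v : ℂ) := by
  simp only [dotProduct, nsq, Pi.star_apply, Complex.ofReal_sum]
  refine Finset.sum_congr rfl fun a _ => ?_
  rw [Complex.star_def, mul_comm, Complex.mul_conj, Complex.normSq_eq_norm_sq]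

theorem norm_star_dotProduct_le (u v : α → ℂ) :
    ‖star u ⬝ᵥ v‖ ≤ √(nsq u) * √(nsq v) := by
  refine (norm_sum_le _ _).trans ?_
  simp only [Pi.star_apply, norm_mul, norm_star]
  exact Real.sum_mul_le_sqrt_mul_sqrt _ _ _

theorem trace_mul_vecMulVec_star (S : Matrix α α ℂ) (u v : α → ℂ) :
    (S * Matrix.vecMulVec v (star u)).trace = star u ⬝ᵥ S *ᵥ v := by
  rw [Matrix.mul_vecMulVec, Matrix.trace_vecMulVec, dotProduct_comm]

variable [DecidableEq α]

/-- For a Hermitian matrix `A` there is a unitary `S`, the sign of `A`, with `|A| = S A`. -/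
theorem exists_sign {A : Matrix α α ℂ} (hA : A.IsHermitian) :
    ∃ S : Matrix α α ℂ, Sᴴ * S = 1 ∧ CFC.abs A = S * A := by
  have hsa : IsSelfAdjoint A := hA
  -- The value at `0` is `1` rather than `0`, so that `f * f = 1` and the sign is unitary even for
  -- singular `A`.
  let f : ℝ → ℝ := fun x => if 0 ≤ x then 1 else -1
  -- The spectrum is finite, hence discrete, so the jump of `f` is harmless to the functional
  -- calculus.
  have hc : ∀ g : ℝ → ℝ, ContinuousOn g (spectrum ℝ A) := fun g =>
    (Set.toFinite (spectrum ℝ A)).continuousOn g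
  refine ⟨cfc f A, ?_, ?_⟩
  · have h1 : (cfc f A)ᴴ = cfc f A := (cfc_predicate f A : IsSelfAdjoint _)
    rw [h1, ← cfc_mul f f A (hc _) (hc _)]
    have : (fun x => f x * f x) = fun _ => (1 : ℝ) := by
      funext x; by_cases h : 0 ≤ x <;> simp [f, h]
    rw [this, cfc_const_one ℝ A hsa]
  · have h : cfc f A * A = cfc (fun x => f x * x) A := by
      rw [cfc_mul f _ A (hc _) (hc _), cfc_id' ℝ A hsa]
    rw [CFC.abs_eq_cfc_norm A hsa, h]
    congr 1
    funext x
    by_cases h : 0 ≤ x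
    · simp [f, h, abs_of_nonneg h]
    · simp [f, h, abs_of_neg (not_le.mp h)]

/-- Cauchy–Schwarz, since `S` is an isometry. This contractivity is all that is kept of the sign
matrix in the estimates. -/
theorem norm_form_le {S : Matrix α α ℂ} (hS : Sᴴ * S = 1) (u v : α → ℂ) :
    ‖star u ⬝ᵥ S *ᵥ v‖ ≤ √(nsq u) * √(nsq v) := by
  have h : nsq (S *ᵥ v) = nsq v := by
    have : (nsq (S *ᵥ v) : ℂ) = nsq v := by
      rw [← star_dotProduct_self, ← star_dotProduct_self, Matrix.star_mulVec,
        Matrix.dotProduct_mulVec, Matrix.vecMul_vecMul, hS, Matrix.vecMul_one]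
    exact_mod_cast this
  simpa [h] using norm_star_dotProduct_le u (S *ᵥ v)

end

/-! ### Fourier analysis on bit strings -/

/-- The nontrivial character of `F_2`. -/
def sgn (t : ZMod 2) : ℂ := if t = 0 then 1 else -1

theorem zmodTwo_cases (t : ZMod 2) : t = 0 ∨ t = 1 := by revert t; decide

theorem sgn_add (s t : ZMod 2) : sgn (s + t) = sgn s * sgn t := by
  have h : (1 + 1 : ZMod 2) = 0 := by decide
  rcases zmodTwo_cases s with rfl | rfl <;> rcases zmodTwo_cases t with rfl | rfl <;>
    simp [sgn, h]

@[simp] theorem sgn_zero : sgn 0 = 1 := by simp [sgn]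

@[simp] theorem sgn_one : sgn 1 = -1 := by simp [sgn]

@[simp] theorem star_sgn (t : ZMod 2) : star (sgn t) = sgn t := by
  rcases zmodTwo_cases t with rfl | rfl <;> simp [sgn]

@[simp] theorem norm_sgn (t : ZMod 2) : ‖sgn t‖ = 1 := by
  rcases zmodTwo_cases t with rfl | rfl <;> simp [sgn]

theorem sgn_sum {ι : Type*} (s : Finset ι) (f : ι → ZMod 2) :
    sgn (∑ j ∈ s, f j) = ∏ j ∈ s, sgn (f j) := by
  classical
  induction s using Finset.induction_on with
  | empty => simp
  | insert a s ha ih => rw [Finset.sum_insert ha, Finset.prod_insert ha, sgn_add, ih]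

/-- A sum vanishes if a translation changes the sign of its terms. -/
theorem sum_eq_zero_of_translate {n : ℕ} (f : Bits n → ℂ) (y : Bits n)
    (h : ∀ x, f (x + y) = -f x) : ∑ x, f x = 0 := by
  have h1 : ∑ x, f x = -∑ x, f x := by
    rw [← Finset.sum_neg_distrib, ← Equiv.sum_comp (Equiv.addRight y) f]
    exact Finset.sum_congr rfl fun x _ => h x
  exact self_eq_neg.mp h1

theorem sum_sgn_dotProduct {n : ℕ} (u : Bits n) :
    ∑ x : Bits n, sgn (u ⬝ᵥ x) = if u = 0 then 2 ^ n else 0 := by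
  split_ifs with hu
  · simp [hu, ZMod.card]
  · obtain ⟨j, hj⟩ := Function.ne_iff.mp hu
    have hj1 : u j = 1 := (zmodTwo_cases (u j)).resolve_left hj
    refine sum_eq_zero_of_translate _ (Pi.single j 1) fun x => ?_
    rw [dotProduct_add, sgn_add, dotProduct_single, hj1]
    simp

theorem bits_add_eq_zero {n : ℕ} {a b : Bits n} : a + b = 0 ↔ a = b := by
  rw [add_eq_zero_iff_eq_neg, ZModModule.neg_eq_self]

/-- Orthogonality of characters. The set of frequencies is arbitrary because the identity is applied
to all of them and to the low and high ones separately. -/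
theorem parseval_scalar {n : ℕ} (s : Finset (Bits n)) (g : Bits n → ℂ) :
    ∑ x : Bits n, ‖∑ a ∈ s, sgn (a ⬝ᵥ x) * g a‖ ^ 2 = 2 ^ n * ∑ a ∈ s, ‖g a‖ ^ 2 := by
  have key : ∀ z : ℂ, ((‖z‖ ^ 2 : ℝ) : ℂ) = z * star z := fun z => by
    rw [Complex.star_def, Complex.mul_conj, Complex.normSq_eq_norm_sq]
  have : ((∑ x : Bits n, ‖∑ a ∈ s, sgn (a ⬝ᵥ x) * g a‖ ^ 2 : ℝ) : ℂ) =
      ((2 ^ n * ∑ a ∈ s, ‖g a‖ ^ 2 : ℝ) : ℂ) := by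
    rw [Complex.ofReal_sum, Complex.ofReal_mul, Complex.ofReal_sum]
    simp_rw [key, star_sum, Finset.sum_mul_sum, star_mul', star_sgn]
    rw [Finset.sum_comm, Finset.mul_sum]
    refine Finset.sum_congr rfl fun a ha => ?_
    rw [Finset.sum_comm]
    have h : ∀ b ∈ s, ∑ x : Bits n, sgn (a ⬝ᵥ x) * g a * (sgn (b ⬝ᵥ x) * star (g b)) =
        if a = b then 2 ^ n * (g a * star (g a)) else 0 := fun b _ => by
      have : ∀ x : Bits n, sgn (a ⬝ᵥ x) * g a * (sgn (b ⬝ᵥ x) * star (g b)) =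
          sgn ((a + b) ⬝ᵥ x) * (g a * star (g b)) := fun x => by
        rw [add_dotProduct, sgn_add]; ring
      simp_rw [this]
      rw [← Finset.sum_mul, sum_sgn_dotProduct]
      simp only [bits_add_eq_zero]
      split_ifs with hab
      · rw [hab]
      · simp
    rw [Finset.sum_congr rfl h, Finset.sum_ite_eq, if_pos ha]
    simp
  exact_mod_cast this

theorem parseval {n : ℕ} {F : Type*} [Fintype F] (s : Finset (Bits n)) (g : Bits n → F → ℂ) :
    ∑ x : Bits n, nsq (∑ a ∈ s, sgn (a ⬝ᵥ x) • g a) = 2 ^ n * ∑ a ∈ s, nsq (g a) := by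
  simp only [nsq, Finset.sum_apply, Pi.smul_apply, smul_eq_mul]
  rw [Finset.sum_comm]
  simp_rw [parseval_scalar]
  rw [← Finset.mul_sum, Finset.sum_comm]

/-- Fourier inversion. -/
theorem sum_sgn_fourier {n : ℕ} {F : Type*} (h : Bits n → F → ℂ) (x : Bits n) :
    ∑ a : Bits n, sgn (a ⬝ᵥ x) • ((2 ^ n : ℂ)⁻¹ • ∑ y, sgn (a ⬝ᵥ y) • h y) = h x := by
  simp_rw [Finset.smul_sum, smul_smul]
  rw [Finset.sum_comm]
  have h1 : ∀ y : Bits n, ∑ a : Bits n, (sgn (a ⬝ᵥ x) * ((2 ^ n)⁻¹ * sgn (a ⬝ᵥ y))) • h y =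
      if x = y then h x else 0 := fun y => by
    have : ∀ a : Bits n, sgn (a ⬝ᵥ x) * ((2 ^ n)⁻¹ * sgn (a ⬝ᵥ y)) =
        (2 ^ n)⁻¹ * sgn ((x + y) ⬝ᵥ a) := fun a => by
      rw [add_dotProduct, sgn_add, dotProduct_comm a x, dotProduct_comm a y]; ring
    simp_rw [this]
    rw [← Finset.sum_smul, ← Finset.mul_sum, sum_sgn_dotProduct]
    simp only [bits_add_eq_zero]
    split_ifs with hxy
    · simp [hxy]
    · simp
  simp [h1]

/-! ### The code -/

namespace Code

variable {n : ℕ} (K : Code n)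

theorem syndrome_apply (x : Bits n) (a : Fin K.r) :
    K.syndrome x a = K.rows (Fin.castAdd K.m a) ⬝ᵥ x := by
  simp only [syndrome, rows, Fin.append_left, Matrix.vecMul_transpose]
  rfl

theorem key_apply (x : Bits n) (a : Fin K.m) :
    K.key x a = K.rows (Fin.natAdd K.r a) ⬝ᵥ x := by
  simp only [key, rows, Fin.append_right, Matrix.vecMul_transpose]
  rfl

theorem syndrome_add (x y : Bits n) : K.syndrome (x + y) = K.syndrome x + K.syndrome y :=
  Matrix.add_vecMul _ _ _

theorem key_add (x y : Bits n) : K.key (x + y) = K.key x + K.key y := Matrix.add_vecMul _ _ _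

/-- A string of weight less than `d_{r,m}` in the span of all rows is in the span of the rows of
`PC`. -/
theorem mem_rowSpan_of_hammingNorm_lt {u : Bits n} (hu : hammingNorm u < K.dist) (t : ℕ)
    (ht : t ≤ K.m) (h : u ∈ K.rowSpan (K.r + t)) : u ∈ K.rowSpan K.r := by
  induction t with
  | zero => exact h
  | succ t ih =>
    refine ih (by omega) ?_
    let l : Fin (K.r + K.m) := ⟨K.r + t, by omega⟩
    have hset : {a : Fin (K.r + K.m) | (a : ℕ) < K.r + (t + 1)} =
        insert l {a : Fin (K.r + K.m) | (a : ℕ) < K.r + t} := by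
      ext a
      simp only [Set.mem_ofPred_eq, Set.mem_insert_iff, Fin.ext_iff, l]
      omega
    rw [rowSpan, hset, Set.image_insert_eq, Submodule.mem_span_insert] at h
    obtain ⟨c, w, hw, h⟩ := h
    rcases zmodTwo_cases c with rfl | rfl
    · rw [zero_smul, zero_add] at h
      exact h ▸ hw
    -- With coefficient `1`, `u` is a row of `PK` plus a vector `w` spanned by the preceding rows,
    -- so its weight is one of the distances whose minimum is `dist`.
    · exfalso
      refine absurd (Nat.sInf_le (s := {d : ℕ | ∃ l : Fin (K.r + K.m), K.r ≤ (l : ℕ) ∧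
        ∃ w ∈ K.rowSpan l, d = hammingDist (K.rows l) w}) ⟨l, Nat.le_add_right _ _, w, hw, rfl⟩) ?_
      rw [not_le, hammingDist_eq_hammingNorm, ZModModule.neg_eq_self]
      rwa [h, one_smul] at hu

theorem rowSpan_top : K.rowSpan (K.r + K.m) = Submodule.span (ZMod 2) (Set.range K.rows) := by
  rw [rowSpan, ← Set.image_univ]
  congr 2
  ext a
  simp

theorem dotProduct_eq_zero_of_mem_rowSpan {u y : Bits n} (hu : u ∈ K.rowSpan K.r)
    (hy : K.syndrome y = 0) : u ⬝ᵥ y = 0 := by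
  induction hu using Submodule.span_induction with
  | mem x h =>
    obtain ⟨a, ha, rfl⟩ := h
    have := K.syndrome_apply y ⟨a, ha⟩
    rw [hy] at this
    exact this.symm
  | zero => simp
  | add x z _ _ hx hz => rw [add_dotProduct, hx, hz, add_zero]
  | smul c x _ hx => rw [smul_dotProduct, hx, smul_zero]

theorem dual_apply_eq_dotProduct (f : Bits n →ₗ[ZMod 2] ZMod 2) (u : Bits n) :
    f u = u ⬝ᵥ fun j => f (Pi.single j 1) := by
  conv_lhs => rw [pi_eq_sum_univ' u]
  simp [dotProduct, map_sum]

/-- A string outside the span of all rows is detected by a string with trivial syndrome and key. -/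
theorem exists_dotProduct_ne_zero {u : Bits n}
    (hu : u ∉ Submodule.span (ZMod 2) (Set.range K.rows)) :
    ∃ y : Bits n, K.syndrome y = 0 ∧ K.key y = 0 ∧ u ⬝ᵥ y ≠ 0 := by
  obtain ⟨f, hfu, hf⟩ := Submodule.exists_le_ker_of_notMem hu
  refine ⟨fun j => f (Pi.single j 1), ?_, ?_, ?_⟩
  · funext a
    rw [syndrome_apply, ← dual_apply_eq_dotProduct]
    exact hf (Submodule.subset_span ⟨_, rfl⟩)
  · funext a
    rw [key_apply, ← dual_apply_eq_dotProduct]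
    exact hf (Submodule.subset_span ⟨_, rfl⟩)
  · rwa [← dual_apply_eq_dotProduct]

/-- Independence of the rows allows a functional to be prescribed on them: `0` on the rows of `PC`,
`κ` on those of `PK`. Extended to the whole space, it is the dot product with some `y`. Translation
by `y` moves the key freely at a constant syndrome. -/
theorem exists_syndrome_eq_zero_key_eq (hK : LinearIndependent (ZMod 2) K.rows)
    (κ : Bits K.m) : ∃ y : Bits n, K.syndrome y = 0 ∧ K.key y = κ := by
  obtain ⟨f, hf⟩ := LinearMap.exists_extend
    ((Module.Basis.span hK).constr (ZMod 2) (Fin.append (0 : Bits K.r) κ))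
  have hrow : ∀ l, f (K.rows l) = Fin.append (0 : Bits K.r) κ l := fun l => by
    have h1 := congrArg (fun g => g (Module.Basis.span hK l)) hf
    rw [Module.Basis.constr_basis] at h1
    simpa only [LinearMap.comp_apply, Submodule.subtype_apply, Module.Basis.span_apply] using h1
  refine ⟨fun j => f (Pi.single j 1), ?_, ?_⟩
  · funext a
    rw [syndrome_apply, ← dual_apply_eq_dotProduct, hrow, Fin.append_left]
  · funext a
    rw [key_apply, ← dual_apply_eq_dotProduct, hrow, Fin.append_right]

/-- Characters of weight less than `d_{r,m}` carry no information on the key. -/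
theorem sum_sgn_mul_key_sub_average (hK : LinearIndependent (ZMod 2) K.rows) {u : Bits n}
    (hu : hammingNorm u < K.dist) (g : Bits K.m → Bits K.r → ℂ) :
    ∑ x : Bits n, sgn (u ⬝ᵥ x) * (g (K.key x) (K.syndrome x) -
      (1 / 2 ^ K.m) * ∑ κ, g κ (K.syndrome x)) = 0 := by
  by_cases hmem : u ∈ Submodule.span (ZMod 2) (Set.range K.rows)
  · have hur : u ∈ K.rowSpan K.r :=
      K.mem_rowSpan_of_hammingNorm_lt hu K.m le_rfl (by rwa [rowSpan_top])
    -- As `u` is in the span of the rows of `PC`, its character is invariant under translations of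
    -- trivial syndrome, so the sum may be averaged over all keys.
    have hshift : ∀ κ : Bits K.m, ∑ x : Bits n, sgn (u ⬝ᵥ x) * g (K.key x) (K.syndrome x) =
        ∑ x : Bits n, sgn (u ⬝ᵥ x) * g (K.key x + κ) (K.syndrome x) := fun κ => by
      obtain ⟨y, hy, rfl⟩ := K.exists_syndrome_eq_zero_key_eq hK κ
      rw [← Equiv.sum_comp (Equiv.addRight y)]
      refine Finset.sum_congr rfl fun x _ => ?_
      rw [Equiv.coe_addRight, syndrome_add, key_add, hy, add_zero, dotProduct_add,
        K.dotProduct_eq_zero_of_mem_rowSpan hur hy, add_zero]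
    have havg : (2 ^ K.m : ℂ) * ∑ x : Bits n, sgn (u ⬝ᵥ x) * g (K.key x) (K.syndrome x) =
        ∑ x : Bits n, sgn (u ⬝ᵥ x) * ∑ κ, g κ (K.syndrome x) := by
      have : (2 ^ K.m : ℂ) * ∑ x : Bits n, sgn (u ⬝ᵥ x) * g (K.key x) (K.syndrome x) =
          ∑ κ : Bits K.m, ∑ x : Bits n, sgn (u ⬝ᵥ x) * g (K.key x + κ) (K.syndrome x) := by
        rw [← Finset.sum_congr rfl fun κ _ => hshift κ]
        simp [ZMod.card]
      rw [this, Finset.sum_comm]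
      refine Finset.sum_congr rfl fun x _ => ?_
      rw [← Finset.mul_sum]
      exact congrArg _ (Equiv.sum_comp (Equiv.addLeft (K.key x)) fun κ => g κ (K.syndrome x))
    simp_rw [mul_sub, Finset.sum_sub_distrib]
    simp_rw [mul_left_comm _ (1 / 2 ^ K.m : ℂ)]
    rw [← Finset.mul_sum, ← havg]
    field_simp
    simp
  -- Here translation by `y` preserves syndrome and key but flips the character, so the sum cancels.
  · obtain ⟨y, hy, hy', huy⟩ := K.exists_dotProduct_ne_zero hmem
    refine sum_eq_zero_of_translate _ y fun x => ?_
    rw [syndrome_add, key_add, hy, hy', add_zero, add_zero, dotProduct_add, sgn_add,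
      (zmodTwo_cases _).resolve_left huy]
    simp

end Code

/-! ### Sampling without replacement -/

open MeasureTheory ProbabilityTheory in
/-- Hoeffding's lemma for a Bernoulli variable. -/
theorem bernoulli_mgf_le {p : ℝ} (hp0 : 0 ≤ p) (hp1 : p ≤ 1) (t : ℝ) :
    1 + p * (Real.exp t - 1) ≤ Real.exp (t * p + t ^ 2 / 8) := by
  let μ : Measure ℝ := ENNReal.ofReal p • Measure.dirac 1 + ENNReal.ofReal (1 - p) • Measure.dirac 0
  have hμ : IsProbabilityMeasure μ := ⟨by
    simp only [μ, Measure.coe_add, Measure.coe_smul, Pi.add_apply, Pi.smul_apply, measure_univ,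
      smul_eq_mul, mul_one]
    rw [← ENNReal.ofReal_add hp0 (by linarith)]
    simp⟩
  have hintegral : ∀ f : ℝ → ℝ, ∫ x, f x ∂μ = p * f 1 + (1 - p) * f 0 := fun f => by
    have hd : ∀ a : ℝ, Integrable f (Measure.dirac a) := fun a =>
      integrable_dirac (by simp [enorm_lt_top])
    rw [integral_add_measure ((hd 1).smul_measure ENNReal.ofReal_ne_top)
      ((hd 0).smul_measure ENNReal.ofReal_ne_top), integral_smul_measure, integral_smul_measure,
      integral_dirac, integral_dirac, ENNReal.toReal_ofReal hp0,
      ENNReal.toReal_ofReal (by linarith)]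
    rfl
  have hb : ∀ᵐ x ∂μ, id x ∈ Set.Icc (0 : ℝ) 1 := by
    rw [ae_add_measure_iff]
    exact ⟨Measure.ae_smul_measure (by simp [ae_dirac_eq]) _,
      Measure.ae_smul_measure (by simp [ae_dirac_eq]) _⟩
  have h := (hasSubgaussianMGF_of_mem_Icc (μ := μ) (X := id) aemeasurable_id hb).mgf_le t
  rw [mgf, hintegral, hintegral] at h
  have hc : (((‖(1 : ℝ) - 0‖₊ / 2) ^ 2 : NNReal) : ℝ) * t ^ 2 / 2 = t ^ 2 / 8 := by
    simp; ring
  rw [hc] at h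
  -- The bound `h` concerns the centred variable; multiplication by `exp (t * p)` removes the
  -- centring.
  have h2 := mul_le_mul_of_nonneg_left h (Real.exp_pos (t * p)).le
  rw [← Real.exp_add] at h2
  refine le_trans (le_of_eq ?_) h2
  simp only [id]
  rw [mul_add, mul_left_comm, ← Real.exp_add, mul_left_comm, ← Real.exp_add]
  ring_nf
  simp only [Real.exp_zero]
  ring

/-- Each factor satisfies `(w - k) / (M - k) ≤ w / M`: `k` draws without replacement all hit a set
of `w` among `M` points with probability at most `(w / M) ^ k`. -/
theorem pow_mul_descFactorial_le {w M : ℕ} (h : w ≤ M) (k : ℕ) :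
    M ^ k * w.descFactorial k ≤ w ^ k * M.descFactorial k := by
  induction k with
  | zero => simp
  | succ k ih =>
    have h1 : M * (w - k) ≤ w * (M - k) := by
      rw [Nat.mul_sub, Nat.mul_sub, Nat.mul_comm M w]
      exact Nat.sub_le_sub_left (Nat.mul_le_mul_right k h) _
    calc M ^ (k + 1) * w.descFactorial (k + 1)
        = (M * (w - k)) * (M ^ k * w.descFactorial k) := by
          rw [Nat.descFactorial_succ, pow_succ]; ring
      _ ≤ (w * (M - k)) * (w ^ k * M.descFactorial k) := Nat.mul_le_mul h1 ih
      _ = w ^ (k + 1) * M.descFactorial (k + 1) := by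
          rw [Nat.descFactorial_succ, pow_succ]; ring

theorem pow_mul_choose_le {w M : ℕ} (h : w ≤ M) (k : ℕ) :
    M ^ k * w.choose k ≤ w ^ k * M.choose k := by
  have h1 := pow_mul_descFactorial_le h k
  rw [Nat.descFactorial_eq_factorial_mul_choose, Nat.descFactorial_eq_factorial_mul_choose,
    mul_left_comm, mul_left_comm (w ^ k)] at h1
  exact Nat.le_of_mul_le_mul_left h1 (Nat.factorial_pos k)

section
variable {α : Type*} [DecidableEq α]

/-- Removing `T` is injective on its supersets. The guard excludes the truncated difference `n -
T.card = 0`, whose binomial coefficient would be `1` and would spoil the comparison with the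
binomial law. -/
theorem card_powersetCard_filter_superset_le (A T : Finset α) (n : ℕ) :
    ((A.powersetCard n).filter (T ⊆ ·)).card ≤
      if T.card ≤ n then (A \ T).card.choose (n - T.card) else 0 := by
  split_ifs with h
  · rw [← Finset.card_powersetCard]
    refine Finset.card_le_card_of_injOn (· \ T) ?_ ?_
    · intro s hs
      simp only [Finset.coe_filter, Finset.mem_powersetCard, Set.mem_ofPred_eq] at hs
      simp only [Finset.mem_coe, Finset.mem_powersetCard]
      exact ⟨Finset.sdiff_subset_sdiff hs.1.1 le_rfl, by
        rw [Finset.card_sdiff_of_subset hs.2, hs.1.2]⟩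
    · intro s hs s' hs' hss
      simp only [Finset.coe_filter, Set.mem_ofPred_eq] at hs hs'
      rw [← Finset.sdiff_union_of_subset hs.2, ← Finset.sdiff_union_of_subset hs'.2]
      exact congrArg (· ∪ T) hss
  · rw [Nat.le_zero, Finset.card_eq_zero, Finset.filter_eq_empty_iff]
    intro s hs hT
    rw [Finset.mem_powersetCard] at hs
    exact h (hs.2 ▸ Finset.card_le_card hT)

/-- The moment generating function of the hypergeometric distribution is dominated by that of the
binomial distribution. -/
theorem hypergeometric_mgf_le {A W : Finset α} (hW : W ⊆ A) {n : ℕ} (hn : n ≤ A.card)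
    (hA : 0 < A.card) {y : ℝ} (hy : 0 ≤ y) :
    ∑ s ∈ A.powersetCard n, (1 + y) ^ (s ∩ W).card ≤
      A.card.choose n * (1 + (W.card : ℝ) / A.card * y) ^ n := by
  set M := A.card
  set w := W.card
  have hwM : w ≤ M := Finset.card_le_card hW
  let c : ℕ → ℝ := fun k => if k ≤ n then ((M - k).choose (n - k) : ℝ) else 0
  -- Expanding `(1 + y) ^ |s ∩ W|` over the subsets of `s ∩ W` replaces the generating function by
  -- factorial moments, with nonnegative coefficients because `y ≥ 0`.
  have h1 : ∑ s ∈ A.powersetCard n, (1 + y) ^ (s ∩ W).card =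
      ∑ T ∈ W.powerset, y ^ T.card * ((A.powersetCard n).filter (T ⊆ ·)).card := by
    have : ∀ s : Finset α, (1 + y) ^ (s ∩ W).card =
        ∑ T ∈ W.powerset, if T ⊆ s then y ^ T.card else 0 := fun s => by
      rw [add_comm, ← Finset.sum_pow_mul_eq_add_pow, ← Finset.sum_filter]
      refine Finset.sum_congr ?_ fun T _ => by simp
      ext T
      rw [Finset.mem_powerset, Finset.mem_filter, Finset.mem_powerset, Finset.subset_inter_iff,
        and_comm]
    simp_rw [this]
    rw [Finset.sum_comm]
    refine Finset.sum_congr rfl fun T _ => ?_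
    rw [← Finset.sum_filter, Finset.sum_const, nsmul_eq_mul, mul_comm]
  have h2 : ∑ T ∈ W.powerset, y ^ T.card * ((A.powersetCard n).filter (T ⊆ ·)).card ≤
      ∑ T ∈ W.powerset, y ^ T.card * c T.card := by
    refine Finset.sum_le_sum fun T hT => mul_le_mul_of_nonneg_left ?_ (by positivity)
    have hTA : T ⊆ A := (Finset.mem_powerset.mp hT).trans hW
    have := card_powersetCard_filter_superset_le A T n
    rw [Finset.card_sdiff_of_subset hTA] at this
    simp only [c]
    exact_mod_cast this
  -- The `k`-th factorial moments are compared one by one, through `C(M,n) C(n,k) = C(M,k)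
  -- C(M-k,n-k)`.
  have h3 : ∀ k ∈ Finset.range (w + 1), w.choose k • (y ^ k * c k) ≤
      M.choose n * ((w / M * y) ^ k * (1 : ℝ) ^ (n - k) * n.choose k) := fun k _ => by
    simp only [c, nsmul_eq_mul, one_pow, mul_one]
    split_ifs with hk
    · have hM : (0 : ℝ) < M ^ k := by positivity
      have e1 : (M : ℝ) ^ k * w.choose k ≤ w ^ k * M.choose k := by
        exact_mod_cast pow_mul_choose_le hwM k
      have e2 : (M.choose n : ℝ) * n.choose k = M.choose k * (M - k).choose (n - k) := by
        exact_mod_cast Nat.choose_mul (n := M) hk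
      have e3 : (w.choose k : ℝ) ≤ (w / M : ℝ) ^ k * M.choose k := by
        rw [div_pow, div_mul_eq_mul_div, le_div_iff₀ hM, mul_comm]
        exact e1
      calc (w.choose k : ℝ) * (y ^ k * (M - k).choose (n - k))
          ≤ ((w / M : ℝ) ^ k * M.choose k) * (y ^ k * (M - k).choose (n - k)) :=
            mul_le_mul_of_nonneg_right e3 (by positivity)
        _ = (w / M * y : ℝ) ^ k * (M.choose k * (M - k).choose (n - k)) := by
            rw [mul_pow]; ring
        _ = _ := by rw [← e2]; ring
    · rw [Nat.choose_eq_zero_of_lt (not_le.mp hk)]; simp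
  rw [h1]
  refine h2.trans ?_
  rw [Finset.sum_powerset_apply_card (fun k => y ^ k * c k)]
  refine (Finset.sum_le_sum h3).trans ?_
  rw [← Finset.mul_sum, add_comm (1 : ℝ), add_pow]
  refine mul_le_mul_of_nonneg_left ?_ (by positivity)
  refine (Finset.sum_le_sum_of_subset_of_nonneg (t := Finset.range (M + 1)) ?_ ?_).trans
    (le_of_eq ?_)
  · exact Finset.range_subset_range.mpr (by omega)
  · intros; positivity
  · symm
    refine Finset.sum_subset (Finset.range_subset_range.mpr (by omega)) fun k _ hk => ?_
    rw [Finset.mem_range, not_lt] at hk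
    rw [Nat.choose_eq_zero_of_lt (by omega)]; simp

/-- Hoeffding's bound for sampling without replacement: it is unlikely that the error rate of the
sample `s` exceeds that of the remaining positions by `ε`. -/
theorem card_bad_samples_le {A W : Finset α} (hW : W ⊆ A) {n l : ℕ} (hA : A.card = n + l)
    (hn : 0 < n) {p ε : ℝ} (hε : 0 ≤ ε) :
    (((A.powersetCard n).filter fun s => n * (p + ε) ≤ ((s ∩ W).card : ℝ) ∧
      ((W \ s).card : ℝ) ≤ l * p).card : ℝ) ≤
      (n + l).choose n * Real.exp (-2 * ((l : ℝ) / (n + l)) ^ 2 * n * ε ^ 2) := by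
  have hn' : (0 : ℝ) < n := by exact_mod_cast hn
  have hM : (0 : ℝ) < n + l := by positivity
  -- If the sample has rate at least `p + ε` and the rest at most `p`, the sample exceeds the
  -- overall rate `q` by at least `t`.
  set t : ℝ := l / (n + l) * ε with ht
  have ht0 : 0 ≤ t := by positivity
  set q : ℝ := (W.card : ℝ) / (n + l) with hq
  have hq0 : 0 ≤ q := by positivity
  have hq1 : q ≤ 1 := by
    rw [hq, div_le_one hM]
    have := Finset.card_le_card hW
    rw [hA] at this
    exact_mod_cast this
  -- Chernoff parameter `4 * t`: it minimizes `λ ^ 2 / 8 - λ * t`, with minimum `-2 * t ^ 2` per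
  -- draw.
  set y : ℝ := Real.exp (4 * t) - 1 with hy
  have hy0 : 0 ≤ y := by
    have := Real.one_le_exp (by positivity : 0 ≤ 4 * t)
    linarith
  have hmgf := hypergeometric_mgf_le hW (n := n) (by omega) (by omega) hy0
  rw [hA] at hmgf
  push_cast at hmgf
  rw [← hq] at hmgf
  have hlow : ((A.powersetCard n).filter fun s => n * (p + ε) ≤ ((s ∩ W).card : ℝ) ∧
      ((W \ s).card : ℝ) ≤ l * p).card * Real.exp (4 * t * (n * (q + t))) ≤
      ∑ s ∈ A.powersetCard n, (1 + y) ^ (s ∩ W).card := by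
    rw [← nsmul_eq_mul, ← Finset.sum_const]
    refine (Finset.sum_le_sum fun s hs => ?_).trans
      (Finset.sum_le_sum_of_subset_of_nonneg (Finset.filter_subset _ _) fun s _ _ => by positivity)
    obtain ⟨-, h1, h2⟩ := Finset.mem_filter.mp hs
    rw [hy, add_sub_cancel, ← Real.exp_nat_mul, Real.exp_le_exp, mul_comm]
    refine mul_le_mul_of_nonneg_right ?_ (by positivity)
    have hw : (W.card : ℝ) = (s ∩ W).card + (W \ s).card := by
      have := Finset.card_sdiff_add_card_inter W s
      rw [Finset.inter_comm] at this
      rw [← this]; push_cast; ring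
    set h : ℝ := ((s ∩ W).card : ℝ)
    set g : ℝ := ((W \ s).card : ℝ)
    have hsum : n * (q + t) = n * (h + g + l * ε) / (n + l) := by
      rw [hq, ht, hw]; field_simp
    rw [hsum, div_le_iff₀ hM]
    have h3 : (l : ℝ) * (n * (p + ε)) ≤ l * h := mul_le_mul_of_nonneg_left h1 (by positivity)
    have h4 : (n : ℝ) * g ≤ n * (l * p) := mul_le_mul_of_nonneg_left h2 hn'.le
    nlinarith
  have hup : (1 + q * y) ^ n ≤ Real.exp (n * (4 * t * q + (4 * t) ^ 2 / 8)) := by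
    rw [Real.exp_nat_mul]
    exact pow_le_pow_left₀ (by positivity) (bernoulli_mgf_le hq0 hq1 _) n
  have htot := (hlow.trans hmgf).trans (mul_le_mul_of_nonneg_left hup (by positivity))
  rw [← le_div_iff₀ (Real.exp_pos _), mul_div_assoc, ← Real.exp_sub] at htot
  refine htot.trans (le_of_eq ?_)
  congr 2
  rw [ht]; ring

end

/-! ### Privacy amplification -/

/-- The normalized Fourier transform. -/
def fourier {n : ℕ} {F : Type*} (h : Bits n → F → ℂ) (a : Bits n) : F → ℂ :=
  (2 ^ n : ℂ)⁻¹ • ∑ y, sgn (a ⬝ᵥ y) • h y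

namespace Code

variable {n : ℕ} (K : Code n) {F : Type*} [Fintype F]

/-- The difference between the form of the actual key and the average of those of all keys. -/
def keyDefect (B : Bits K.m → Bits K.r → Matrix F F ℂ) (x : Bits n) : Matrix F F ℂ :=
  B (K.key x) (K.syndrome x) - (1 / 2 ^ K.m : ℂ) • ∑ κ, B κ (K.syndrome x)

theorem dotProduct_keyDefect (B : Bits K.m → Bits K.r → Matrix F F ℂ) (x : Bits n)
    (u v : F → ℂ) :
    star u ⬝ᵥ K.keyDefect B x *ᵥ v = star u ⬝ᵥ B (K.key x) (K.syndrome x) *ᵥ v -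
      (1 / 2 ^ K.m : ℂ) * ∑ κ, star u ⬝ᵥ B κ (K.syndrome x) *ᵥ v := by
  rw [keyDefect, Matrix.sub_mulVec, dotProduct_sub, Matrix.smul_mulVec, dotProduct_smul,
    Matrix.sum_mulVec, dotProduct_sum, smul_eq_mul]

variable {K}

theorem norm_keyDefect_le {B : Bits K.m → Bits K.r → Matrix F F ℂ}
    (hB : ∀ κ ξ u v, ‖star u ⬝ᵥ B κ ξ *ᵥ v‖ ≤ √(nsq u) * √(nsq v)) (x : Bits n) (u v : F → ℂ) :
    ‖star u ⬝ᵥ K.keyDefect B x *ᵥ v‖ ≤ 2 * (√(nsq u) * √(nsq v)) := by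
  rw [dotProduct_keyDefect, two_mul]
  refine (norm_sub_le _ _).trans (add_le_add (hB _ _ _ _) ?_)
  rw [norm_mul]
  have h1 : ‖∑ κ : Bits K.m, star u ⬝ᵥ B κ (K.syndrome x) *ᵥ v‖ ≤
      2 ^ K.m * (√(nsq u) * √(nsq v)) := by
    refine (norm_sum_le _ _).trans ((Finset.sum_le_sum fun κ _ => hB _ _ _ _).trans ?_)
    simp [ZMod.card]
  refine (mul_le_mul_of_nonneg_left h1 (norm_nonneg _)).trans (le_of_eq ?_)
  simp

/-- If only Fourier components of weight less than half of `d_{r,m}` are present, then nothing is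
known on the key. -/
theorem sum_keyDefect_low (hK : LinearIndependent (ZMod 2) K.rows)
    (B : Bits K.m → Bits K.r → Matrix F F ℂ) (g : Bits n → F → ℂ) {s : Finset (Bits n)}
    (hs : ∀ a ∈ s, 2 * hammingNorm a < K.dist) :
    ∑ x : Bits n, star (∑ a ∈ s, sgn (a ⬝ᵥ x) • g a) ⬝ᵥ K.keyDefect B x *ᵥ
      (∑ a ∈ s, sgn (a ⬝ᵥ x) • g a) = 0 := by
  have h1 : ∀ x : Bits n, star (∑ a ∈ s, sgn (a ⬝ᵥ x) • g a) ⬝ᵥ K.keyDefect B x *ᵥ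
      (∑ a ∈ s, sgn (a ⬝ᵥ x) • g a) =
      ∑ a ∈ s, ∑ b ∈ s, sgn ((a + b) ⬝ᵥ x) * (star (g a) ⬝ᵥ K.keyDefect B x *ᵥ g b) := fun x => by
    rw [star_sum, sum_dotProduct]
    refine Finset.sum_congr rfl fun a _ => ?_
    rw [Matrix.mulVec_sum, dotProduct_sum]
    refine Finset.sum_congr rfl fun b _ => ?_
    rw [star_smul, star_sgn, smul_dotProduct, Matrix.mulVec_smul, dotProduct_smul, add_dotProduct,
      sgn_add, smul_eq_mul, smul_eq_mul, mul_assoc]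
  simp_rw [h1]
  rw [Finset.sum_comm]
  refine Finset.sum_eq_zero fun a ha => ?_
  rw [Finset.sum_comm]
  refine Finset.sum_eq_zero fun b hb => ?_
  simp_rw [dotProduct_keyDefect]
  refine K.sum_sgn_mul_key_sub_average hK ?_ fun κ ξ => star (g a) ⬝ᵥ B κ ξ *ᵥ g b
  -- The cross term of `a` and `b` carries the character of `a + b`, whose weight is below `dist`
  -- because each of `a`, `b` has weight below half of it.
  have htri : hammingNorm (a + b) ≤ hammingNorm a + hammingNorm b := by
    have := hammingDist_triangle a 0 b
    rwa [hammingDist_zero_right, hammingDist_zero_left, hammingDist_eq_hammingNorm,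
      ZModModule.neg_eq_self] at this
  have := hs a ha
  have := hs b hb
  omega

theorem sum_sqrt_nsq_mul_le {ι : Type*} [Fintype ι] (u v : ι → F → ℂ) :
    ∑ x, √(nsq (u x)) * √(nsq (v x)) ≤ √(∑ x, nsq (u x)) * √(∑ x, nsq (v x)) := by
  refine (Real.sum_mul_le_sqrt_mul_sqrt _ _ _).trans (le_of_eq ?_)
  simp_rw [Real.sq_sqrt (nsq_nonneg _)]

/-- The low-low part of the form vanishes. Two terms containing the high part remain; each costs `2`
from `norm_keyDefect_le` and `2 ^ n` from Parseval. -/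
theorem norm_sum_keyDefect_fourier_le (hK : LinearIndependent (ZMod 2) K.rows)
    {B : Bits K.m → Bits K.r → Matrix F F ℂ}
    (hB : ∀ κ ξ u v, ‖star u ⬝ᵥ B κ ξ *ᵥ v‖ ≤ √(nsq u) * √(nsq v)) (g : Bits n → F → ℂ) :
    ‖∑ x : Bits n, star (∑ a, sgn (a ⬝ᵥ x) • g a) ⬝ᵥ K.keyDefect B x *ᵥ
      (∑ a, sgn (a ⬝ᵥ x) • g a)‖ ≤
      4 * 2 ^ n * (√(∑ a, nsq (g a)) *
        √(∑ a with K.dist ≤ 2 * hammingNorm a, nsq (g a))) := by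
  set high : Finset (Bits n) := {a | K.dist ≤ 2 * hammingNorm a}
  set low : Finset (Bits n) := {a | ¬ K.dist ≤ 2 * hammingNorm a}
  let h : Bits n → F → ℂ := fun x => ∑ a, sgn (a ⬝ᵥ x) • g a
  let l : Bits n → F → ℂ := fun x => ∑ a ∈ low, sgn (a ⬝ᵥ x) • g a
  let r : Bits n → F → ℂ := fun x => ∑ a ∈ high, sgn (a ⬝ᵥ x) • g a
  have hsplit : ∀ x, h x = r x + l x := fun x =>
    (Finset.sum_filter_add_sum_filter_not _ _ _).symm
  have hq : ∀ x, star (h x) ⬝ᵥ K.keyDefect B x *ᵥ h x =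
      star (l x) ⬝ᵥ K.keyDefect B x *ᵥ l x +
        (star (r x) ⬝ᵥ K.keyDefect B x *ᵥ h x + star (l x) ⬝ᵥ K.keyDefect B x *ᵥ r x) :=
    fun x => by
      conv_lhs => rw [show star (h x) = star (r x) + star (l x) by rw [hsplit, star_add],
        add_dotProduct]
      nth_rewrite 2 [hsplit]
      rw [Matrix.mulVec_add, dotProduct_add]
      ring
  have hzero : ∑ x, star (l x) ⬝ᵥ K.keyDefect B x *ᵥ l x = 0 :=
    sum_keyDefect_low hK B g fun a ha => not_le.mp (Finset.mem_filter.mp ha).2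
  have hlow : ∑ a ∈ low, nsq (g a) ≤ ∑ a, nsq (g a) :=
    Finset.sum_le_sum_of_subset_of_nonneg (Finset.subset_univ _) fun a _ _ => nsq_nonneg _
  have hsq : √((2 : ℝ) ^ n) * √((2 : ℝ) ^ n) = 2 ^ n := Real.mul_self_sqrt (by positivity)
  have h1 : ∑ x, √(nsq (r x)) * √(nsq (h x)) ≤
      2 ^ n * (√(∑ a, nsq (g a)) * √(∑ a ∈ high, nsq (g a))) := by
    refine (sum_sqrt_nsq_mul_le r h).trans (le_of_eq ?_)
    rw [parseval, parseval, Real.sqrt_mul (by positivity), Real.sqrt_mul (by positivity)]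
    linear_combination (√(∑ a, nsq (g a)) * √(∑ a ∈ high, nsq (g a))) * hsq
  have h2 : ∑ x, √(nsq (l x)) * √(nsq (r x)) ≤
      2 ^ n * (√(∑ a, nsq (g a)) * √(∑ a ∈ high, nsq (g a))) := by
    refine (sum_sqrt_nsq_mul_le l r).trans ?_
    rw [parseval, parseval, Real.sqrt_mul (by positivity), Real.sqrt_mul (by positivity)]
    have := mul_le_mul_of_nonneg_right (Real.sqrt_le_sqrt hlow)
      (Real.sqrt_nonneg (∑ a ∈ high, nsq (g a)))
    refine (le_of_eq ?_).trans (mul_le_mul_of_nonneg_left this (by positivity))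
    linear_combination (√(∑ a ∈ low, nsq (g a)) * √(∑ a ∈ high, nsq (g a))) * hsq
  change ‖∑ x, star (h x) ⬝ᵥ K.keyDefect B x *ᵥ h x‖ ≤ _
  simp_rw [hq]
  rw [Finset.sum_add_distrib, hzero, zero_add]
  refine (norm_sum_le _ _).trans ((Finset.sum_le_sum fun x _ => (norm_add_le _ _).trans
    (add_le_add (norm_keyDefect_le hB x _ _) (norm_keyDefect_le hB x _ _))).trans ?_)
  rw [Finset.sum_add_distrib, ← Finset.mul_sum, ← Finset.mul_sum]
  linarith

/-- The information on the key contained in the states `∑_y |E_{x,y}⟩⟨E_{x,y}|` is bounded by the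
weight of the Fourier components at least half of `d_{r,m}`. -/
theorem norm_sum_keyDefect_le (hK : LinearIndependent (ZMod 2) K.rows)
    {B : Bits K.m → Bits K.r → Matrix F F ℂ}
    (hB : ∀ κ ξ u v, ‖star u ⬝ᵥ B κ ξ *ᵥ v‖ ≤ √(nsq u) * √(nsq v))
    (E : Bits n → Bits n → F → ℂ) :
    ‖∑ x, ∑ y, star (E x y) ⬝ᵥ K.keyDefect B x *ᵥ E x y‖ ≤
      4 * 2 ^ n * (√(∑ c, ∑ a, nsq (fourier (fun x => E x (x + c)) a)) *
        √(∑ c, ∑ a with K.dist ≤ 2 * hammingNorm a, nsq (fourier (fun x => E x (x + c)) a))) := by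
  -- The sum is reorganized by the error string `c = x + y`, at which the Fourier transform in `x`
  -- is taken; Cauchy–Schwarz over `c` follows.
  have h1 : ∑ x, ∑ y, star (E x y) ⬝ᵥ K.keyDefect B x *ᵥ E x y =
      ∑ c, ∑ x, star (E x (x + c)) ⬝ᵥ K.keyDefect B x *ᵥ E x (x + c) := by
    rw [Finset.sum_comm (f := fun c x => star (E x (x + c)) ⬝ᵥ K.keyDefect B x *ᵥ E x (x + c))]
    refine Finset.sum_congr rfl fun x _ => ?_
    exact (Equiv.sum_comp (Equiv.addLeft x)
      fun y => star (E x y) ⬝ᵥ K.keyDefect B x *ᵥ E x y).symm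
  rw [h1]
  refine (norm_sum_le _ _).trans ((Finset.sum_le_sum (g := fun c => 4 * 2 ^ n *
    (√(∑ a, nsq (fourier (fun x => E x (x + c)) a)) *
      √(∑ a with K.dist ≤ 2 * hammingNorm a, nsq (fourier (fun x => E x (x + c)) a))))
    fun c _ => ?_).trans ?_)
  · have := norm_sum_keyDefect_fourier_le hK hB (fourier fun x => E x (x + c))
    simpa only [fourier, sum_sgn_fourier] using this
  · rw [← Finset.mul_sum]
    refine mul_le_mul_of_nonneg_left ((Real.sum_mul_le_sqrt_mul_sqrt _ _ _).trans (le_of_eq ?_))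
      (by positivity)
    have hnn : ∀ (c : Bits n) (s : Finset (Bits n)),
        0 ≤ ∑ a ∈ s, nsq (fourier (fun x => E x (x + c)) a) :=
      fun c s => Finset.sum_nonneg fun a _ => nsq_nonneg _
    simp_rw [Real.sq_sqrt (hnn _ _)]

end Code

/-! ### Collective attacks -/

theorem sum_zmodTwo {M : Type*} [AddCommMonoid M] (f : ZMod 2 → M) : ∑ t, f t = f 0 + f 1 :=
  Fin.sum_univ_two f

theorem one_add_one_zmodTwo : (1 + 1 : ZMod 2) = 0 := by decide

theorem parallelogram_complex (z w : ℂ) :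
    ‖z + w‖ ^ 2 + ‖z - w‖ ^ 2 = 2 * (‖z‖ ^ 2 + ‖w‖ ^ 2) := by
  have := parallelogram_law_with_norm ℝ z w
  nlinarith

theorem ket_zero (i t : ZMod 2) : ket 0 i t = if t = i then 1 else 0 := by simp [ket]

theorem ket_one (i t : ZMod 2) : ket 1 i t = sgn (i * t) / (√2 : ℂ) := by
  rcases zmodTwo_cases i with rfl | rfl <;> rcases zmodTwo_cases t with rfl | rfl <;>
    simp [ket]

theorem nsq_ket (b i : ZMod 2) : nsq (ket b i) = 1 := by
  rcases zmodTwo_cases b with rfl | rfl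
  · simp [nsq, ket_zero, apply_ite]
  · simp [nsq, ket_one]

namespace CollectiveAttack

variable {N : ℕ} (𝒜 : CollectiveAttack N)

theorem probeVec_zero (j : Fin N) (i i' : ZMod 2) (e : Fin (𝒜.dim j)) :
    𝒜.probeVec j 0 i i' e = 𝒜.afterAttack j 0 i (e, i') := by
  simp [probeVec, ket_zero, apply_ite]

theorem nsq_afterAttack (j : Fin N) (b i : ZMod 2) : nsq (𝒜.afterAttack j b i) = 1 := by
  have hU : (𝒜.U j : Matrix (Fin (𝒜.dim j) × ZMod 2) (Fin (𝒜.dim j) × ZMod 2) ℂ)ᴴ * 𝒜.U j = 1 :=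
    Matrix.UnitaryGroup.star_mul_self (𝒜.U j)
  have h : nsq (𝒜.afterAttack j b i) =
      nsq (fun et : Fin (𝒜.dim j) × ZMod 2 => 𝒜.init j et.1 * ket b i et.2) := by
    have : (nsq (𝒜.afterAttack j b i) : ℂ) =
        nsq (fun et : Fin (𝒜.dim j) × ZMod 2 => 𝒜.init j et.1 * ket b i et.2) := by
      rw [afterAttack, ← star_dotProduct_self, ← star_dotProduct_self, Matrix.star_mulVec,
        Matrix.dotProduct_mulVec, Matrix.vecMul_vecMul, hU, Matrix.vecMul_one]
    exact_mod_cast this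
  rw [h, nsq, Fintype.sum_prod_type]
  simp_rw [norm_mul, mul_pow, ← Finset.mul_sum]
  have hk : ∑ t, ‖ket b i t‖ ^ 2 = 1 := nsq_ket b i
  rw [hk]
  simpa using 𝒜.init_unit j

theorem afterAttack_one (j : Fin N) (i : ZMod 2) :
    𝒜.afterAttack j 1 i = ∑ x, ket 1 i x • 𝒜.afterAttack j 0 x := by
  simp only [afterAttack, ← Matrix.mulVec_smul, ← Matrix.mulVec_sum]
  congr 1
  funext et
  simp [Finset.sum_apply, ket_zero, mul_comm]

/-- The amplitudes in the `x` basis in terms of those in the `z` basis. -/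
theorem probeVec_one (j : Fin N) (i i' : ZMod 2) (e : Fin (𝒜.dim j)) :
    𝒜.probeVec j 1 i i' e =
      (1 / 2 : ℂ) * ∑ x, ∑ y, sgn (i * x) * sgn (i' * y) * 𝒜.probeVec j 0 x y e := by
  have hs : ((√2 : ℝ) : ℂ) * ((√2 : ℝ) : ℂ) = 2 := by
    rw [← Complex.ofReal_mul, Real.mul_self_sqrt (by norm_num)]; norm_num
  have hs0 : ((√2 : ℝ) : ℂ) ≠ 0 := fun h => by simp [h] at hs
  simp only [probeVec_zero]
  simp only [probeVec, afterAttack_one, Finset.sum_apply, Pi.smul_apply,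
    smul_eq_mul, ket_one, Finset.mul_sum]
  rw [Finset.sum_comm]
  refine Finset.sum_congr rfl fun x _ => Finset.sum_congr rfl fun y _ => ?_
  have h1 : star (sgn (i' * y) / ((√2 : ℝ) : ℂ)) = sgn (i' * y) / ((√2 : ℝ) : ℂ) := by
    rw [star_div₀, star_sgn, Complex.star_def, Complex.conj_ofReal]
  rw [h1]
  have h2 : ((√2 : ℝ) : ℂ) ^ 2 = 2 := by rw [sq, hs]
  field_simp
  rw [h2]
  ring

theorem sum_nsq_probeVec (j : Fin N) (b i : ZMod 2) : ∑ i', nsq (𝒜.probeVec j b i i') = 1 := by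
  rw [← 𝒜.nsq_afterAttack j b i]
  simp only [nsq]
  rw [Finset.sum_comm, Fintype.sum_prod_type]
  refine Finset.sum_congr rfl fun e _ => ?_
  rcases zmodTwo_cases b with rfl | rfl
  · simp_rw [probeVec_zero]
  · have hs : ‖((√2 : ℝ) : ℂ)‖ ^ 2 = 2 := by simp
    have h1 : ∀ i', 𝒜.probeVec j 1 i i' e =
        (∑ t, sgn (i' * t) * 𝒜.afterAttack j 1 i (e, t)) / ((√2 : ℝ) : ℂ) := fun i' => by
      rw [probeVec, Finset.sum_div]
      refine Finset.sum_congr rfl fun t _ => ?_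
      rw [ket_one, star_div₀, star_sgn, Complex.star_def, Complex.conj_ofReal]
      ring
    simp_rw [h1, norm_div, div_pow, hs, sum_zmodTwo]
    have := parallelogram_complex (𝒜.afterAttack j 1 i (e, 0)) (𝒜.afterAttack j 1 i (e, 1))
    simp only [mul_zero, mul_one, sgn_zero, sgn_one, one_mul, neg_one_mul, ← sub_eq_add_neg]
    linarith

/-- The probability of the error `a` in the `x` basis on the `j`-th qubit. -/
def errX (j : Fin N) (a : ZMod 2) : ℝ := (1 / 2) * ∑ x, nsq (𝒜.probeVec j 1 x (x + a))

theorem errX_nonneg (j : Fin N) (a : ZMod 2) : 0 ≤ 𝒜.errX j a :=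
  mul_nonneg (by norm_num) (Finset.sum_nonneg fun _ _ => nsq_nonneg _)

theorem sum_errX (j : Fin N) : ∑ a, 𝒜.errX j a = 1 := by
  simp only [errX]
  rw [← Finset.mul_sum, Finset.sum_comm]
  have h : ∀ x : ZMod 2, ∑ a, nsq (𝒜.probeVec j 1 x (x + a)) = 1 := fun x => by
    rw [← 𝒜.sum_nsq_probeVec j 1 x]
    exact Equiv.sum_comp (Equiv.addLeft x) fun y => nsq (𝒜.probeVec j 1 x y)
  simp [h]

/-- The error probabilities in the `x` basis are the squared norms of the Fourier components of
the amplitudes in the `z` basis. -/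
theorem errX_eq (j : Fin N) (a : ZMod 2) :
    𝒜.errX j a =
      ∑ c, nsq fun e => (1 / 2 : ℂ) * ∑ x, sgn (a * x) * 𝒜.probeVec j 0 x (x + c) e := by
  simp only [errX, nsq]
  rw [Finset.sum_comm, Finset.sum_comm (s := Finset.univ (α := ZMod 2)), Finset.mul_sum]
  refine Finset.sum_congr rfl fun e _ => ?_
  simp only [probeVec_one, sum_zmodTwo]
  set p := 𝒜.probeVec j 0 0 0 e
  set q := 𝒜.probeVec j 0 0 1 e
  set r := 𝒜.probeVec j 0 1 0 e
  set s := 𝒜.probeVec j 0 1 1 e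
  have hhalf : ‖(1 / 2 : ℂ)‖ = 1 / 2 := by norm_num
  simp only [norm_mul, hhalf, mul_pow]
  rcases zmodTwo_cases a with rfl | rfl
  -- `p + s` and `q + r` are the components for `c = 0` and `c = 1`; their sum and difference are
  -- the two `x`-basis amplitudes.
  · have h := parallelogram_complex (p + s) (q + r)
    simp only [one_add_one_zmodTwo, mul_zero, mul_one, zero_add, add_zero, sgn_zero,
      sgn_one, one_mul, neg_one_mul, neg_neg]
    rw [show p + q + (r + s) = p + s + (q + r) by ring,
      show p + -q + (-r + s) = p + s - (q + r) by ring]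
    linarith
  · have h := parallelogram_complex (p - s) (q - r)
    simp only [one_add_one_zmodTwo, mul_zero, mul_one, zero_add, add_zero, sgn_zero,
      sgn_one, one_mul, neg_one_mul]
    rw [show p + -q + (r + -s) = p - s - (q - r) by ring,
      show p + q + (-r + -s) = p - s + (q - r) by ring,
      show p + -s = p - s by ring, show q + -r = q - r by ring]
    linarith

theorem sum_probe_prod (f : ∀ j, Fin (𝒜.dim j) → ℝ) :
    ∑ e : 𝒜.Probe, ∏ j, f j (e j) = ∏ j, ∑ e, f j e := by
  rw [Finset.prod_univ_sum, Fintype.piFinset_univ]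

theorem outcomeProb_eq_prod (b i iB : Bits N) :
    𝒜.outcomeProb b i iB = ∏ j, nsq (𝒜.probeVec j (b j) (i j) (iB j)) := by
  simp only [outcomeProb, eveVec, norm_prod, ← Finset.prod_pow, nsq]
  exact 𝒜.sum_probe_prod fun j e => ‖𝒜.probeVec j (b j) (i j) (iB j) e‖ ^ 2

theorem sum_outcomeProb (b i : Bits N) : ∑ iB, 𝒜.outcomeProb b i iB = 1 := by
  simp_rw [outcomeProb_eq_prod]
  rw [← Fintype.piFinset_univ,
    ← Finset.prod_univ_sum (fun _ => Finset.univ) fun j t => nsq (𝒜.probeVec j (b j) (i j) t)]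
  simp [sum_nsq_probeVec]

end CollectiveAttack

/-! ### Random partitions -/

/-- The set of positions where a string is `1`. -/
def supp {N : ℕ} (s : Bits N) : Finset (Fin N) := {j | s j ≠ 0}

theorem mem_supp {N : ℕ} {s : Bits N} {j : Fin N} : j ∈ supp s ↔ s j ≠ 0 := by simp [supp]

theorem mem_supp_iff_eq_one {N : ℕ} {s : Bits N} {j : Fin N} : j ∈ supp s ↔ s j = 1 := by
  rw [mem_supp]
  rcases zmodTwo_cases (s j) with h | h <;> simp [h]

theorem card_supp {N : ℕ} (s : Bits N) : (supp s).card = hammingNorm s := rfl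

theorem supp_injective {N : ℕ} : Function.Injective (supp (N := N)) := fun s t h => by
  funext j
  have h1 : j ∈ supp s ↔ j ∈ supp t := by rw [h]
  rw [mem_supp, mem_supp, not_iff_not] at h1
  rcases zmodTwo_cases (s j) with h2 | h2 <;> rcases zmodTwo_cases (t j) with h3 | h3 <;>
    simp_all

/-- The string with a given support. -/
def indicator {N : ℕ} (A : Finset (Fin N)) : Bits N := fun j => if j ∈ A then 1 else 0

@[simp] theorem supp_indicator {N : ℕ} (A : Finset (Fin N)) : supp (indicator A) = A := by
  ext j
  simp [mem_supp, indicator]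

theorem hammingNorm_indicator {N : ℕ} (A : Finset (Fin N)) :
    hammingNorm (indicator A) = A.card := by
  rw [← card_supp, supp_indicator]

theorem exists_orderEmbOfFin_eq {N k : ℕ} {s : Bits N} (hs : (supp s).card = k) {j : Fin N}
    (hj : s j ≠ 0) : ∃ a, (supp s).orderEmbOfFin hs a = j := by
  have : j ∈ Set.range ((supp s).orderEmbOfFin hs) := by
    rw [Finset.range_orderEmbOfFin]; exact mem_supp.mpr hj
  exact this

theorem hammingNorm_substring {N k : ℕ} (s : Bits N) (hs : hammingNorm s = k) (i : Bits N) :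
    hammingNorm (substring s hs i) = (supp s ∩ supp i).card := by
  have h : supp s ∩ supp i = (supp (substring s hs i)).map
      ((supp s).orderEmbOfFin hs).toEmbedding := by
    ext j
    simp only [Finset.mem_inter, Finset.mem_map, mem_supp, RelEmbedding.coe_toEmbedding]
    constructor
    · rintro ⟨h1, h2⟩
      obtain ⟨a, rfl⟩ := exists_orderEmbOfFin_eq hs h1
      exact ⟨a, h2, rfl⟩
    · rintro ⟨a, h1, rfl⟩
      exact ⟨mem_supp.mp (Finset.orderEmbOfFin_mem (supp s) hs a), h1⟩
  rw [h, Finset.card_map, card_supp]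

theorem apply_ne_zero_of_hammingNorm_eq {N : ℕ} {s : Bits N} (h : hammingNorm s = N) (j : Fin N) :
    s j ≠ 0 := by
  have : supp s = Finset.univ := Finset.eq_univ_of_card _ (by rw [card_supp, h, Fintype.card_fin])
  exact mem_supp.mp (this ▸ Finset.mem_univ j)

namespace Partition

variable {n nz nx : ℕ} (P : Partition n nz nx)

/-- The enumeration of the positions given by a partition. -/
def position : Fin n ⊕ (Fin nz ⊕ Fin nx) → Fin (n + nz + nx) :=
  Sum.elim ((supp P.1.1).orderEmbOfFin P.2.1)
    (Sum.elim ((supp P.1.2.1).orderEmbOfFin P.2.2.1) ((supp P.1.2.2).orderEmbOfFin P.2.2.2.1))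

/-- The weight condition on `s + z + b` says directly only that the three supports cover all
positions. Disjointness follows by counting: a surjection between sets of equal size is injective.
-/
theorem position_bijective : Function.Bijective P.position := by
  rw [Fintype.bijective_iff_surjective_and_card]
  refine ⟨fun j => ?_, by simp; omega⟩
  have h := apply_ne_zero_of_hammingNorm_eq P.2.2.2.2 j
  by_cases h1 : P.1.1 j = 0
  · by_cases h2 : P.1.2.1 j = 0
    · obtain ⟨a, ha⟩ := exists_orderEmbOfFin_eq P.2.2.2.1
        (show P.1.2.2 j ≠ 0 by simpa [h1, h2] using h)
      exact ⟨Sum.inr (Sum.inr a), ha⟩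
    · obtain ⟨a, ha⟩ := exists_orderEmbOfFin_eq P.2.2.1 h2
      exact ⟨Sum.inr (Sum.inl a), ha⟩
  · obtain ⟨a, ha⟩ := exists_orderEmbOfFin_eq P.2.1 h1
    exact ⟨Sum.inl a, ha⟩

/-- The enumeration of the positions as an equivalence. -/
def positionEquiv : Fin n ⊕ (Fin nz ⊕ Fin nx) ≃ Fin (n + nz + nx) :=
  Equiv.ofBijective P.position P.position_bijective

/-- The INFO positions. -/
def infoPos (a : Fin n) : Fin (n + nz + nx) := P.position (Sum.inl a)

/-- The TEST-Z positions. -/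
def testZPos (a : Fin nz) : Fin (n + nz + nx) := P.position (Sum.inr (Sum.inl a))

/-- The TEST-X positions. -/
def testXPos (a : Fin nx) : Fin (n + nz + nx) := P.position (Sum.inr (Sum.inr a))

theorem apply_cases (j : Fin (n + nz + nx)) :
    (P.1.1 j = 1 ∧ P.1.2.1 j = 0 ∧ P.1.2.2 j = 0) ∨ (P.1.1 j = 0 ∧ P.1.2.1 j = 1 ∧ P.1.2.2 j = 0) ∨
      (P.1.1 j = 0 ∧ P.1.2.1 j = 0 ∧ P.1.2.2 j = 1) := by
  have hsz : ¬ (P.1.1 j = 1 ∧ P.1.2.1 j = 1) := fun ⟨h1, h2⟩ => by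
    obtain ⟨a, ha⟩ := exists_orderEmbOfFin_eq P.2.1 (j := j) (by simp [h1])
    obtain ⟨b, hb⟩ := exists_orderEmbOfFin_eq P.2.2.1 (j := j) (by simp [h2])
    exact absurd (P.position_bijective.1 (a₁ := Sum.inl a) (a₂ := Sum.inr (Sum.inl b))
      (ha.trans hb.symm)) (by simp)
  have hsb : ¬ (P.1.1 j = 1 ∧ P.1.2.2 j = 1) := fun ⟨h1, h2⟩ => by
    obtain ⟨a, ha⟩ := exists_orderEmbOfFin_eq P.2.1 (j := j) (by simp [h1])
    obtain ⟨b, hb⟩ := exists_orderEmbOfFin_eq P.2.2.2.1 (j := j) (by simp [h2])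
    exact absurd (P.position_bijective.1 (a₁ := Sum.inl a) (a₂ := Sum.inr (Sum.inr b))
      (ha.trans hb.symm)) (by simp)
  have hzb : ¬ (P.1.2.1 j = 1 ∧ P.1.2.2 j = 1) := fun ⟨h1, h2⟩ => by
    obtain ⟨a, ha⟩ := exists_orderEmbOfFin_eq P.2.2.1 (j := j) (by simp [h1])
    obtain ⟨b, hb⟩ := exists_orderEmbOfFin_eq P.2.2.2.1 (j := j) (by simp [h2])
    exact absurd (P.position_bijective.1 (a₁ := Sum.inr (Sum.inl a)) (a₂ := Sum.inr (Sum.inr b))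
      (ha.trans hb.symm)) (by simp)
  have h : P.1.1 j + P.1.2.1 j + P.1.2.2 j ≠ 0 := apply_ne_zero_of_hammingNorm_eq P.2.2.2.2 j
  rcases zmodTwo_cases (P.1.1 j) with h1 | h1 <;> rcases zmodTwo_cases (P.1.2.1 j) with h2 | h2 <;>
    rcases zmodTwo_cases (P.1.2.2 j) with h3 | h3 <;> simp_all

theorem bases_infoPos (a : Fin n) : P.bases (P.infoPos a) = 0 := by
  have : P.1.1 (P.infoPos a) ≠ 0 :=
    mem_supp.mp (Finset.orderEmbOfFin_mem (supp P.1.1) P.2.1 a)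
  rcases P.apply_cases (P.infoPos a) with h | h | h
  · exact h.2.2
  · exact h.2.2
  · exact absurd h.1 this

theorem bases_testZPos (a : Fin nz) : P.bases (P.testZPos a) = 0 := by
  have : P.1.2.1 (P.testZPos a) ≠ 0 :=
    mem_supp.mp (Finset.orderEmbOfFin_mem (supp P.1.2.1) P.2.2.1 a)
  rcases P.apply_cases (P.testZPos a) with h | h | h
  · exact h.2.2
  · exact h.2.2
  · exact absurd h.2.1 this

theorem bases_testXPos (a : Fin nx) : P.bases (P.testXPos a) = 1 :=
  mem_supp_iff_eq_one.mp (Finset.orderEmbOfFin_mem (supp P.1.2.2) P.2.2.2.1 a)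

theorem prod_position {M : Type*} [CommMonoid M] (f : Fin (n + nz + nx) → M) :
    ∏ j, f j = (∏ a, f (P.infoPos a)) * ((∏ a, f (P.testZPos a)) * ∏ a, f (P.testXPos a)) := by
  rw [← Equiv.prod_comp P.positionEquiv, Fintype.prod_sum_type, Fintype.prod_sum_type]
  rfl

/-- The decomposition of strings into the INFO, TEST-Z and TEST-X substrings. -/
def bitsEquiv : Bits (n + nz + nx) ≃ Bits n × Bits nz × Bits nx :=
  (P.positionEquiv.symm.arrowCongr (Equiv.refl _)).trans
    ((Equiv.sumArrowEquivProdArrow _ _ _).trans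
      ((Equiv.refl _).prodCongr (Equiv.sumArrowEquivProdArrow _ _ _)))

theorem bitsEquiv_apply (i : Bits (n + nz + nx)) :
    P.bitsEquiv i = (P.info i, P.testZ i, P.testX i) := rfl

/-- The string with given INFO, TEST-Z and TEST-X substrings. -/
def join (x : Bits n) (t : Bits nz) (u : Bits nx) : Bits (n + nz + nx) :=
  P.bitsEquiv.symm (x, t, u)

variable (x : Bits n) (t : Bits nz) (u : Bits nx)

theorem bitsEquiv_join : (P.info (P.join x t u), P.testZ (P.join x t u), P.testX (P.join x t u)) =
    (x, t, u) := by
  rw [← bitsEquiv_apply, join, Equiv.apply_symm_apply]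

@[simp] theorem info_join : P.info (P.join x t u) = x :=
  congrArg (fun q => q.1) (P.bitsEquiv_join x t u)

@[simp] theorem testZ_join : P.testZ (P.join x t u) = t :=
  congrArg (fun q => q.2.1) (P.bitsEquiv_join x t u)

@[simp] theorem testX_join : P.testX (P.join x t u) = u :=
  congrArg (fun q => q.2.2) (P.bitsEquiv_join x t u)

@[simp] theorem join_infoPos (a : Fin n) : P.join x t u (P.infoPos a) = x a :=
  congrFun (P.info_join x t u) a

@[simp] theorem join_testZPos (a : Fin nz) : P.join x t u (P.testZPos a) = t a :=
  congrFun (P.testZ_join x t u) a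

@[simp] theorem join_testXPos (a : Fin nx) : P.join x t u (P.testXPos a) = u a :=
  congrFun (P.testX_join x t u) a

theorem sum_join {M : Type*} [AddCommMonoid M] (f : Bits (n + nz + nx) → M) :
    ∑ i, f i = ∑ x, ∑ t, ∑ u, f (P.join x t u) := by
  rw [← Equiv.sum_comp P.bitsEquiv.symm, Fintype.sum_prod_type]
  simp_rw [Fintype.sum_prod_type]
  rfl

theorem testZ_add (i i' : Bits (n + nz + nx)) : P.testZ (i + i') = P.testZ i + P.testZ i' := rfl

theorem testX_add (i i' : Bits (n + nz + nx)) : P.testX (i + i') = P.testX i + P.testX i' := rfl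

theorem info_add (i i' : Bits (n + nz + nx)) : P.info (i + i') = P.info i + P.info i' := rfl

end Partition

/-- Fixing one kind of test positions, the partitions correspond to the choices of the INFO set `f
P` in the remaining set `A`, and `g P` is the rest. This transfers the sampling bound to both
comparisons, with TEST-Z and with TEST-X. -/
theorem card_bad_le_of_bijOn {N n l : ℕ} {ι : Type*} (Q : Finset ι)
    (f g : ι → Finset (Fin N)) (A C : Finset (Fin N)) (hA : A.card = n + l) (hn : 0 < n)
    (hg : ∀ P ∈ Q, g P = A \ f P) (hf : Set.BijOn f Q (A.powersetCard n : Finset _))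
    {p ε : ℝ} (hε : 0 ≤ ε)
    (bad : ι → Prop) [DecidablePred bad]
    (hbad : ∀ P ∈ Q, bad P → n * (p + ε) ≤ ((f P ∩ C).card : ℝ) ∧ ((g P ∩ C).card : ℝ) ≤ l * p) :
    ((Q.filter bad).card : ℝ) ≤
      Q.card * Real.exp (-2 * ((l : ℝ) / (n + l)) ^ 2 * n * ε ^ 2) := by
  classical
  have hQ : (n + l).choose n ≤ Q.card := by
    rw [← hA, ← Finset.card_powersetCard]
    exact Finset.card_le_card_of_surjOn f hf.surjOn
  have h1 := card_bad_samples_le (Finset.inter_subset_left (s₁ := A) (s₂ := C)) hA hn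
    (p := p) hε
  refine le_trans ?_ (h1.trans (mul_le_mul_of_nonneg_right (by exact_mod_cast hQ)
    (Real.exp_pos _).le))
  refine Nat.cast_le.mpr (Finset.card_le_card_of_injOn f ?_
    (hf.injOn.mono fun P hP => (Finset.mem_filter.mp hP).1))
  intro P hP
  obtain ⟨hPQ, hP⟩ := Finset.mem_filter.mp hP
  have hfP := hf.mapsTo hPQ
  obtain ⟨h2, h3⟩ := hbad P hPQ hP
  refine Finset.mem_filter.mpr ⟨hfP, ?_, ?_⟩
  · rwa [← Finset.inter_assoc, Finset.inter_eq_left.mpr (Finset.mem_powersetCard.mp hfP).1]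
  · rwa [Finset.inter_comm, Finset.inter_sdiff_assoc, Finset.inter_comm, ← hg P hPQ]

open scoped Classical in
/-- Given the TEST-X positions, the error rate on the INFO bits rarely exceeds that on the TEST-Z
bits. -/
theorem card_bad_testZ_le {n nz nx : ℕ} (hn : 0 < n) {p ε : ℝ} (hε : 0 ≤ ε)
    (b c : Bits (n + nz + nx)) :
    ((Finset.univ.filter fun P : Partition n nz nx => P.bases = b ∧
      n * (p + ε) ≤ (hammingNorm (P.info c) : ℝ) ∧
        (hammingNorm (P.testZ c) : ℝ) ≤ nz * p).card : ℝ) ≤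
      (Finset.univ.filter fun P : Partition n nz nx => P.bases = b).card *
        Real.exp (-2 * ((nz : ℝ) / (n + nz)) ^ 2 * n * ε ^ 2) := by
  rw [← Finset.filter_filter]
  by_cases hb : hammingNorm b = nx
  swap
  · have : (Finset.univ.filter fun P : Partition n nz nx => P.bases = b) = ∅ :=
      Finset.filter_eq_empty_iff.mpr fun P _ h => hb (h ▸ P.2.2.2.1)
    simp [this]
  have hcard : (supp b)ᶜ.card = n + nz := by
    rw [Finset.card_compl, card_supp, hb, Fintype.card_fin]; omega
  refine card_bad_le_of_bijOn _ (fun P => supp P.1.1) (fun P => supp P.1.2.1) (supp b)ᶜ (supp c)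
    hcard hn ?_ ⟨?_, ?_, ?_⟩ (p := p) hε _ ?_
  · intro P hP
    obtain rfl := (Finset.mem_filter.mp hP).2
    ext j
    simp only [Finset.mem_sdiff, Finset.mem_compl, mem_supp, Partition.bases]
    rcases P.apply_cases j with h | h | h <;> simp [h]
  · intro P hP
    obtain rfl := (Finset.mem_filter.mp hP).2
    refine Finset.mem_powersetCard.mpr ⟨fun j => ?_, P.2.1⟩
    simp only [Finset.mem_compl, mem_supp, Partition.bases]
    rcases P.apply_cases j with h | h | h <;> simp [h]
  · intro P hP P' hP' h
    have hs := supp_injective h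
    have hbb : P.1.2.2 = P'.1.2.2 :=
      (Finset.mem_filter.mp hP).2.trans (Finset.mem_filter.mp hP').2.symm
    have hz : P.1.2.1 = P'.1.2.1 := by
      funext j
      have h1 := congrFun hs j
      have h2 := congrFun hbb j
      rcases P.apply_cases j with h | h | h <;> rcases P'.apply_cases j with h' | h' | h' <;>
        simp_all
    exact Subtype.ext (Prod.ext hs (Prod.ext hz hbb))
  · intro s hs
    obtain ⟨hsA, hsn⟩ := Finset.mem_powersetCard.mp hs
    refine ⟨⟨(indicator s, indicator ((supp b)ᶜ \ s), b), ?_, ?_, hb, ?_⟩, ?_, ?_⟩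
    · rw [hammingNorm_indicator, hsn]
    · rw [hammingNorm_indicator, Finset.card_sdiff_of_subset hsA, hcard, hsn]; omega
    · rw [← card_supp, show supp _ = Finset.univ from ?_, Finset.card_univ, Fintype.card_fin]
      ext j
      have : j ∈ s → b j = 0 := fun h => by simpa [mem_supp] using hsA h
      by_cases h1 : j ∈ s
      · simp [mem_supp, indicator, h1, this h1]
      · by_cases h2 : b j = 0 <;> simp [mem_supp, indicator, h1, h2]
    · exact Finset.mem_filter.mpr ⟨Finset.mem_univ _, rfl⟩
    · simp
  · rintro P - h
    rwa [Partition.info, Partition.testZ, hammingNorm_substring, hammingNorm_substring] at h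

open scoped Classical in
/-- The error rate on the INFO positions rarely exceeds that on the TEST-X positions, for any
distribution of the errors that does not depend on the partition. -/
theorem card_bad_testX_le {n nz nx : ℕ} (hn : 0 < n) {p ε : ℝ} (hε : 0 ≤ ε)
    (c : Bits (n + nz + nx)) :
    ((Finset.univ.filter fun P : Partition n nz nx =>
      n * (p + ε) ≤ (hammingNorm (P.info c) : ℝ) ∧
        (hammingNorm (P.testX c) : ℝ) ≤ nx * p).card : ℝ) ≤
      Fintype.card (Partition n nz nx) *
        Real.exp (-2 * ((nx : ℝ) / (n + nx)) ^ 2 * n * ε ^ 2) := by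
  -- The estimate is made for each fixed TEST-Z string and then summed over these strings.
  have hfib : ∀ z : Bits (n + nz + nx),
      (((Finset.univ.filter fun P : Partition n nz nx => P.1.2.1 = z).filter fun P =>
      n * (p + ε) ≤ (hammingNorm (P.info c) : ℝ) ∧
        (hammingNorm (P.testX c) : ℝ) ≤ nx * p).card : ℝ) ≤
      (Finset.univ.filter fun P : Partition n nz nx => P.1.2.1 = z).card *
        Real.exp (-2 * ((nx : ℝ) / (n + nx)) ^ 2 * n * ε ^ 2) := by
    intro b
    by_cases hb : hammingNorm b = nz
    swap
    · have : (Finset.univ.filter fun P : Partition n nz nx => P.1.2.1 = b) = ∅ :=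
        Finset.filter_eq_empty_iff.mpr fun P _ h => hb (h ▸ P.2.2.1)
      simp [this]
    have hcard : (supp b)ᶜ.card = n + nx := by
      rw [Finset.card_compl, card_supp, hb, Fintype.card_fin]; omega
    refine card_bad_le_of_bijOn _ (fun P => supp P.1.1) (fun P => supp P.1.2.2) (supp b)ᶜ (supp c)
      hcard hn ?_ ⟨?_, ?_, ?_⟩ (p := p) hε _ ?_
    · intro P hP
      obtain rfl := (Finset.mem_filter.mp hP).2
      ext j
      simp only [Finset.mem_sdiff, Finset.mem_compl, mem_supp]
      rcases P.apply_cases j with h | h | h <;> simp [h]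
    · intro P hP
      obtain rfl := (Finset.mem_filter.mp hP).2
      refine Finset.mem_powersetCard.mpr ⟨fun j => ?_, P.2.1⟩
      simp only [Finset.mem_compl, mem_supp]
      rcases P.apply_cases j with h | h | h <;> simp [h]
    · intro P hP P' hP' h
      have hs := supp_injective h
      have hzz : P.1.2.1 = P'.1.2.1 :=
        (Finset.mem_filter.mp hP).2.trans (Finset.mem_filter.mp hP').2.symm
      have hbb : P.1.2.2 = P'.1.2.2 := by
        funext j
        have h1 := congrFun hs j
        have h2 := congrFun hzz j
        rcases P.apply_cases j with h | h | h <;> rcases P'.apply_cases j with h' | h' | h' <;>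
          simp_all
      exact Subtype.ext (Prod.ext hs (Prod.ext hzz hbb))
    · intro s hs
      obtain ⟨hsA, hsn⟩ := Finset.mem_powersetCard.mp hs
      refine ⟨⟨(indicator s, b, indicator ((supp b)ᶜ \ s)), ?_, hb, ?_, ?_⟩, ?_, ?_⟩
      · rw [hammingNorm_indicator, hsn]
      · rw [hammingNorm_indicator, Finset.card_sdiff_of_subset hsA, hcard, hsn]; omega
      · rw [← card_supp, show supp _ = Finset.univ from ?_, Finset.card_univ, Fintype.card_fin]
        ext j
        have : j ∈ s → b j = 0 := fun h => by simpa [mem_supp] using hsA h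
        by_cases h1 : j ∈ s
        · simp [mem_supp, indicator, h1, this h1]
        · by_cases h2 : b j = 0 <;> simp [mem_supp, indicator, h1, h2]
      · simp
      · simp
    · rintro P - h
      rwa [Partition.info, Partition.testX, hammingNorm_substring, hammingNorm_substring] at h
  rw [Finset.card_eq_sum_card_fiberwise (f := fun P : Partition n nz nx => P.1.2.1)
    (t := Finset.univ) (by simp [Set.MapsTo]), ← Finset.card_univ (α := Partition n nz nx),
    Finset.card_eq_sum_card_fiberwise (s := Finset.univ (α := Partition n nz nx))
      (f := fun P : Partition n nz nx => P.1.2.1) (t := Finset.univ) (by simp [Set.MapsTo]),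
    Nat.cast_sum, Nat.cast_sum, Finset.sum_mul]
  refine Finset.sum_le_sum fun z _ => ?_
  rw [Finset.filter_comm]
  exact hfib z

/-! ### Reliability and secrecy -/

theorem sum_comm_outer_inner {α β γ : Type*} [Fintype α] [Fintype β] [Fintype γ]
    (f : α → β → β → γ → ℝ) :
    ∑ p, ∑ i, ∑ j, ∑ b, f p i j b = ∑ b, ∑ i, ∑ j, ∑ p, f p i j b := by
  have h1 : ∀ p, ∑ i, ∑ j, ∑ b, f p i j b = ∑ b, ∑ i, ∑ j, f p i j b := fun p =>
    (Finset.sum_congr rfl fun i _ => Finset.sum_comm).trans Finset.sum_comm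
  have h2 : ∀ b, ∑ p, ∑ i, ∑ j, f p i j b = ∑ i, ∑ j, ∑ p, f p i j b := fun b =>
    Finset.sum_comm.trans (Finset.sum_congr rfl fun i _ => Finset.sum_comm)
  simp_rw [h1]
  rw [Finset.sum_comm]
  simp_rw [h2]

section
variable {n nz nx : ℕ} (𝒜 : CollectiveAttack (n + nz + nx)) (P : Partition n nz nx)

theorem sum_probe_position (f : ∀ k, Fin (𝒜.dim (P.infoPos k)) → ℝ)
    (g : ∀ k, Fin (𝒜.dim (P.testZPos k)) → ℝ) (h : ∀ k, Fin (𝒜.dim (P.testXPos k)) → ℝ) :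
    ∑ e : 𝒜.Probe, (∏ k, f k (e (P.infoPos k))) *
        ((∏ k, g k (e (P.testZPos k))) * ∏ k, h k (e (P.testXPos k))) =
      (∏ k, ∑ e, f k e) * ((∏ k, ∑ e, g k e) * ∏ k, ∑ e, h k e) := by
  let F : ∀ a, Fin (𝒜.dim (P.positionEquiv a)) → ℝ := fun a => match a with
    | Sum.inl k => f k
    | Sum.inr (Sum.inl k) => g k
    | Sum.inr (Sum.inr k) => h k
  have h1 : ∀ e : 𝒜.Probe, (∏ k, f k (e (P.infoPos k))) *
        ((∏ k, g k (e (P.testZPos k))) * ∏ k, h k (e (P.testXPos k))) =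
      ∏ a, F a (e (P.positionEquiv a)) := fun e => by
    rw [Fintype.prod_sum_type, Fintype.prod_sum_type]
    rfl
  simp_rw [h1]
  rw [← Equiv.sum_comp (Equiv.piCongrLeft (fun j => Fin (𝒜.dim j)) P.positionEquiv)]
  simp_rw [Equiv.piCongrLeft_apply_apply]
  rw [← Fintype.piFinset_univ, ← Finset.prod_univ_sum (fun _ => Finset.univ) F,
    Fintype.prod_sum_type, Fintype.prod_sum_type]
  rfl

theorem eveVec_join (x y : Bits n) (t t' : Bits nz) (u u' : Bits nx) (e : 𝒜.Probe) :
    𝒜.eveVec P.bases (P.join x t u) (P.join y t' u') e =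
      (∏ k, 𝒜.probeVec (P.infoPos k) 0 (x k) (y k) (e (P.infoPos k))) *
        ((∏ k, 𝒜.probeVec (P.testZPos k) 0 (t k) (t' k) (e (P.testZPos k))) *
          ∏ k, 𝒜.probeVec (P.testXPos k) 1 (u k) (u' k) (e (P.testXPos k))) := by
  rw [CollectiveAttack.eveVec, P.prod_position]
  simp only [Partition.bases_infoPos, Partition.bases_testZPos, Partition.bases_testXPos,
    Partition.join_infoPos, Partition.join_testZPos, Partition.join_testXPos]

/-- Both the character and Eve's vector are products over positions, so the transform acts on each
INFO qubit separately and leaves the test qubits untouched. -/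
theorem fourier_eveVec (a c : Bits n) (t t' : Bits nz) (u u' : Bits nx) (e : 𝒜.Probe) :
    fourier (fun x => 𝒜.eveVec P.bases (P.join x t u) (P.join (x + c) t' u')) a e =
      (∏ k, (1 / 2 : ℂ) * ∑ x, sgn (a k * x) *
          𝒜.probeVec (P.infoPos k) 0 x (x + c k) (e (P.infoPos k))) *
        ((∏ k, 𝒜.probeVec (P.testZPos k) 0 (t k) (t' k) (e (P.testZPos k))) *
          ∏ k, 𝒜.probeVec (P.testXPos k) 1 (u k) (u' k) (e (P.testXPos k))) := by
  rw [Finset.prod_mul_distrib, Finset.prod_univ_sum, Fintype.piFinset_univ]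
  simp only [fourier, Pi.smul_apply, Finset.sum_apply, smul_eq_mul, eveVec_join, Pi.add_apply,
    dotProduct, sgn_sum, Finset.prod_const, Finset.card_univ, Fintype.card_fin, one_div, inv_pow]
  rw [mul_assoc, Finset.sum_mul]
  congr 1
  refine Finset.sum_congr rfl fun x _ => ?_
  rw [Finset.prod_mul_distrib, mul_assoc]

/-- The probability of the outcomes of the test bits. -/
def testProb (t t' : Bits nz) (u u' : Bits nx) : ℝ :=
  (∏ k, nsq (𝒜.probeVec (P.testZPos k) 0 (t k) (t' k))) *
    ∏ k, nsq (𝒜.probeVec (P.testXPos k) 1 (u k) (u' k))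

theorem testProb_nonneg (t t' : Bits nz) (u u' : Bits nx) : 0 ≤ testProb 𝒜 P t t' u u' :=
  mul_nonneg (Finset.prod_nonneg fun _ _ => nsq_nonneg _)
    (Finset.prod_nonneg fun _ _ => nsq_nonneg _)

/-- Complementarity for all INFO qubits: `errX_eq` is applied position by position, after summing
over the `z`-basis error string `c`. -/
theorem sum_nsq_fourier_eveVec (a : Bits n) (t t' : Bits nz) (u u' : Bits nx) :
    ∑ c, nsq (fourier (fun x => 𝒜.eveVec P.bases (P.join x t u) (P.join (x + c) t' u')) a) =
      (∏ k, 𝒜.errX (P.infoPos k) (a k)) * testProb 𝒜 P t t' u u' := by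
  have h : ∀ c, nsq (fourier (fun x => 𝒜.eveVec P.bases (P.join x t u)
      (P.join (x + c) t' u')) a) =
      (∏ k, nsq fun e => (1 / 2 : ℂ) * ∑ x, sgn (a k * x) *
        𝒜.probeVec (P.infoPos k) 0 x (x + c k) e) * testProb 𝒜 P t t' u u' := fun c => by
    rw [nsq]
    simp_rw [fourier_eveVec]
    simp only [norm_mul (∏ k, (_ : ℂ)), norm_prod]
    simp only [mul_pow (∏ k, (_ : ℝ)), ← Finset.prod_pow]
    exact sum_probe_position 𝒜 P
      (fun k e => ‖(1 / 2 : ℂ) * ∑ x, sgn (a k * x) * 𝒜.probeVec (P.infoPos k) 0 x (x + c k) e‖ ^ 2)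
      (fun k e => ‖𝒜.probeVec (P.testZPos k) 0 (t k) (t' k) e‖ ^ 2)
      (fun k e => ‖𝒜.probeVec (P.testXPos k) 1 (u k) (u' k) e‖ ^ 2)
  simp_rw [h]
  rw [← Finset.sum_mul]
  congr 1
  simp_rw [CollectiveAttack.errX_eq]
  rw [Finset.prod_univ_sum, Fintype.piFinset_univ]

theorem sum_prod_errX {k : ℕ} (q : Fin k → Fin (n + nz + nx)) :
    ∑ a : Bits k, ∏ j, 𝒜.errX (q j) (a j) = 1 := by
  rw [← Fintype.piFinset_univ,
    ← Finset.prod_univ_sum (fun _ => Finset.univ) fun j t => 𝒜.errX (q j) t]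
  simp [CollectiveAttack.sum_errX]

/-- The probability, in the `x` basis, of at least `d / 2` errors on the INFO positions. -/
def highProb (d : ℕ) : ℝ :=
  ∑ a : Bits n with d ≤ 2 * hammingNorm a, ∏ k, 𝒜.errX (P.infoPos k) (a k)

open scoped Classical in
/-- The probability of passing the TEST-X part of the test. -/
def passProb (px : ℝ) : ℝ :=
  ∑ c : Bits nx with (hammingNorm c : ℝ) / nx ≤ px, ∏ k, 𝒜.errX (P.testXPos k) (c k)

theorem prod_errX_nonneg {k : ℕ} (q : Fin k → Fin (n + nz + nx)) (a : Bits k) :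
    0 ≤ ∏ j, 𝒜.errX (q j) (a j) := Finset.prod_nonneg fun _ _ => 𝒜.errX_nonneg _ _

theorem highProb_nonneg (d : ℕ) : 0 ≤ highProb 𝒜 P d :=
  Finset.sum_nonneg fun _ _ => prod_errX_nonneg 𝒜 _ _

theorem passProb_nonneg (px : ℝ) : 0 ≤ passProb 𝒜 P px :=
  Finset.sum_nonneg fun _ _ => prod_errX_nonneg 𝒜 _ _

theorem passProb_le_one (px : ℝ) : passProb 𝒜 P px ≤ 1 := by
  classical
  rw [← sum_prod_errX 𝒜 P.testXPos]
  exact Finset.sum_le_sum_of_subset_of_nonneg (Finset.filter_subset _ _)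
    fun _ _ _ => prod_errX_nonneg 𝒜 _ _

/-- `testProb` factors out of both square roots, and the total Fourier weight of the INFO part is
`1`. -/
theorem norm_sum_info_le {K : Code n} (hK : LinearIndependent (ZMod 2) K.rows)
    {B : Bits K.m → Bits K.r → Matrix 𝒜.Probe 𝒜.Probe ℂ}
    (hB : ∀ κ ξ u v, ‖star u ⬝ᵥ B κ ξ *ᵥ v‖ ≤ √(nsq u) * √(nsq v))
    (t t' : Bits nz) (u u' : Bits nx) :
    ‖∑ x, ∑ y, star (𝒜.eveVec P.bases (P.join x t u) (P.join y t' u')) ⬝ᵥ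
        K.keyDefect B x *ᵥ 𝒜.eveVec P.bases (P.join x t u) (P.join y t' u')‖ ≤
      4 * 2 ^ n * (testProb 𝒜 P t t' u u' * √(highProb 𝒜 P K.dist)) := by
  refine (Code.norm_sum_keyDefect_le hK hB
    fun x y => 𝒜.eveVec P.bases (P.join x t u) (P.join y t' u')).trans (le_of_eq ?_)
  congr 1
  have hs : ∀ s : Finset (Bits n), ∑ c, ∑ a ∈ s, nsq (fourier (fun x =>
      𝒜.eveVec P.bases (P.join x t u) (P.join (x + c) t' u')) a) =
      (∑ a ∈ s, ∏ k, 𝒜.errX (P.infoPos k) (a k)) * testProb 𝒜 P t t' u u' := fun s => by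
    rw [Finset.sum_comm, Finset.sum_mul]
    exact Finset.sum_congr rfl fun a _ => sum_nsq_fourier_eveVec 𝒜 P a t t' u u'
  rw [hs, hs, sum_prod_errX, one_mul, mul_comm (∑ a with _, _),
    Real.sqrt_mul (testProb_nonneg _ _ _ _ _ _), ← mul_assoc,
    Real.mul_self_sqrt (testProb_nonneg _ _ _ _ _ _)]
  rfl

open scoped Classical in
-- The TEST-Z condition is dropped, since only TEST-X controls secrecy. Summing over Alice's test
-- bits without normalization produces the powers of `2`.
theorem sum_testProb_le (pz px : ℝ) :
    (∑ t : Bits nz, ∑ u : Bits nx, ∑ t' : Bits nz, ∑ u' : Bits nx,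
      if (hammingNorm (t + t') : ℝ) / nz ≤ pz ∧ (hammingNorm (u + u') : ℝ) / nx ≤ px
      then testProb 𝒜 P t t' u u' else 0) ≤ 2 ^ nz * 2 ^ nx * passProb 𝒜 P px := by
  let G : Bits nz → Bits nz → ℝ := fun t t' => ∏ k, nsq (𝒜.probeVec (P.testZPos k) 0 (t k) (t' k))
  let H : Bits nx → Bits nx → ℝ := fun u u' => ∏ k, nsq (𝒜.probeVec (P.testXPos k) 1 (u k) (u' k))
  have hG : ∀ t, ∑ t', G t t' = 1 := fun t => by
    simp only [G]
    rw [← Fintype.piFinset_univ, ← Finset.prod_univ_sum (fun _ => Finset.univ)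
      fun k s => nsq (𝒜.probeVec (P.testZPos k) 0 (t k) s)]
    simp [CollectiveAttack.sum_nsq_probeVec]
  have hH : ∀ c : Bits nx, ∑ u, H u (u + c) = 2 ^ nx * ∏ k, 𝒜.errX (P.testXPos k) (c k) :=
    fun c => by
      simp only [H, CollectiveAttack.errX, Pi.add_apply]
      rw [← Fintype.piFinset_univ, ← Finset.prod_univ_sum (fun _ => Finset.univ)
        fun k s => nsq (𝒜.probeVec (P.testXPos k) 1 s (s + c k)), Finset.prod_mul_distrib]
      simp
  calc _ ≤ ∑ t : Bits nz, ∑ u : Bits nx, ∑ t' : Bits nz, ∑ u' : Bits nx,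
      G t t' * (if (hammingNorm (u + u') : ℝ) / nx ≤ px then H u u' else 0) := by
        refine Finset.sum_le_sum fun t _ => Finset.sum_le_sum fun u _ =>
          Finset.sum_le_sum fun t' _ => Finset.sum_le_sum fun u' _ => ?_
        have hnn := testProb_nonneg 𝒜 P t t' u u'
        by_cases h2 : (hammingNorm (u + u') : ℝ) / nx ≤ px
        · by_cases h1 : (hammingNorm (t + t') : ℝ) / nz ≤ pz
          · rw [if_pos ⟨h1, h2⟩, if_pos h2]; rfl
          · rw [if_neg fun h => h1 h.1, if_pos h2]; exact hnn
        · rw [if_neg fun h => h2 h.2, if_neg h2, mul_zero]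
    _ = 2 ^ nz * ∑ u : Bits nx, ∑ u' : Bits nx,
          (if (hammingNorm (u + u') : ℝ) / nx ≤ px then H u u' else 0) := by
        have : ∀ t u, ∑ t' : Bits nz, ∑ u' : Bits nx,
            G t t' * (if (hammingNorm (u + u') : ℝ) / nx ≤ px then H u u' else 0) =
            ∑ u' : Bits nx, (if (hammingNorm (u + u') : ℝ) / nx ≤ px then H u u' else 0) :=
          fun t u => by
            simp_rw [← Finset.mul_sum]
            rw [← Finset.sum_mul, hG, one_mul]
        simp_rw [this]
        simp [ZMod.card]
    _ = 2 ^ nz * 2 ^ nx * passProb 𝒜 P px := by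
        rw [mul_assoc, passProb, Finset.mul_sum (s := Finset.filter _ _), Finset.sum_filter]
        congr 1
        simp_rw [← hH]
        have : ∀ u : Bits nx, ∑ u' : Bits nx,
            (if (hammingNorm (u + u') : ℝ) / nx ≤ px then H u u' else 0) =
            ∑ c : Bits nx, (if (hammingNorm c : ℝ) / nx ≤ px then H u (u + c) else 0) := fun u => by
          rw [← Equiv.sum_comp (Equiv.addLeft u)]
          refine Finset.sum_congr rfl fun c _ => ?_
          rw [Equiv.coe_addLeft, ← add_assoc, ZModModule.add_self, zero_add]
        simp_rw [this]
        rw [Finset.sum_comm]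
        refine Finset.sum_congr rfl fun c _ => ?_
        split_ifs <;> simp

open scoped Classical in
-- The product is the probability of one event when all qubits are sent and measured in the `x`
-- basis, with the TEST-Z outcomes summed out. The law of `c` no longer involves `P`, as sampling
-- requires.
theorem highProb_mul_passProb (d : ℕ) (px : ℝ) :
    highProb 𝒜 P d * passProb 𝒜 P px =
      ∑ c : Bits (n + nz + nx), if d ≤ 2 * hammingNorm (P.info c) ∧
        (hammingNorm (P.testX c) : ℝ) / nx ≤ px then ∏ j, 𝒜.errX j (c j) else 0 := by
  rw [P.sum_join, highProb, passProb, Finset.sum_filter, Finset.sum_filter, Finset.sum_mul_sum]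
  refine Finset.sum_congr rfl fun x _ => ?_
  rw [Finset.sum_comm]
  refine Finset.sum_congr rfl fun u _ => ?_
  simp_rw [P.prod_position fun j => 𝒜.errX j _, Partition.info_join, Partition.testX_join,
    Partition.join_infoPos, Partition.join_testZPos, Partition.join_testXPos]
  by_cases h : d ≤ 2 * hammingNorm x ∧ (hammingNorm u : ℝ) / nx ≤ px
  · simp_rw [if_pos h, if_pos h.1, if_pos h.2]
    rw [← Finset.mul_sum, ← Finset.sum_mul, sum_prod_errX, one_mul]
  · simp_rw [if_neg h]
    rw [Finset.sum_const_zero, mul_eq_zero]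
    rw [not_and_or] at h
    exact h.imp (fun h => if_neg h) fun h => if_neg h

end

/-- The average over the partitions of the probability that, in the `x` basis, the test is passed
in spite of at least `d / 2` errors on the INFO positions. -/
theorem sum_highProb_mul_passProb_le {n nz nx : ℕ} (𝒜 : CollectiveAttack (n + nz + nx))
    (hn : 0 < n) (hnx : 0 < nx) {d : ℕ} {px ε : ℝ} (hε : 0 ≤ ε) (hd : n * (px + ε) ≤ d / 2) :
    ∑ P : Partition n nz nx, highProb 𝒜 P d * passProb 𝒜 P px ≤
      Fintype.card (Partition n nz nx) *
        Real.exp (-2 * ((nx : ℝ) / (n + nx)) ^ 2 * n * ε ^ 2) := by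
  classical
  have hnx' : (0 : ℝ) < nx := by exact_mod_cast hnx
  set X := Fintype.card (Partition n nz nx) *
    Real.exp (-2 * ((nx : ℝ) / (n + nx)) ^ 2 * n * ε ^ 2)
  simp_rw [highProb_mul_passProb]
  rw [Finset.sum_comm]
  calc _ ≤ ∑ c : Bits (n + nz + nx), X * ∏ j, 𝒜.errX j (c j) := by
        refine Finset.sum_le_sum fun c _ => ?_
        rw [← Finset.sum_filter, Finset.sum_const, nsmul_eq_mul]
        refine mul_le_mul_of_nonneg_right (le_trans ?_ (card_bad_testX_le hn (p := px) hε c))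
          (prod_errX_nonneg 𝒜 id c)
        refine Nat.cast_le.mpr (Finset.card_le_card fun P hP => ?_)
        obtain ⟨-, h1, h2⟩ := Finset.mem_filter.mp hP
        refine Finset.mem_filter.mpr ⟨Finset.mem_univ _, hd.trans ?_, ?_⟩
        · have : (d : ℝ) ≤ 2 * hammingNorm (P.info c) := by exact_mod_cast h1
          linarith
        · rwa [div_le_iff₀ hnx', mul_comm] at h2
    _ = X := by
        have h1 : ∑ c : Bits (n + nz + nx), ∏ j, 𝒜.errX j (c j) = 1 := sum_prod_errX 𝒜 id
        rw [← Finset.mul_sum, h1, mul_one]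

open scoped Classical in
/-- Secrecy: Eve's states contain little information on the key. -/
theorem norm_sum_runs_keyDefect_le {n nz nx : ℕ} (𝒜 : CollectiveAttack (n + nz + nx)) {K : Code n}
    (hK : LinearIndependent (ZMod 2) K.rows) (hn : 0 < n) (hnx : 0 < nx) {pz px ε : ℝ}
    (hε : 0 ≤ ε) (hd : n * (px + ε) ≤ K.dist / 2)
    (B : Bits K.m → Public K nz nx → Matrix 𝒜.Probe 𝒜.Probe ℂ)
    (hB : ∀ κ w u v, ‖star u ⬝ᵥ B κ w *ᵥ v‖ ≤ √(nsq u) * √(nsq v)) :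
    ‖∑ P : Partition n nz nx, ∑ i, ∑ iB, if P.TestPassed pz px i iB then
      star (𝒜.eveVec P.bases i iB) ⬝ᵥ
        K.keyDefect (fun κ ξ => B κ ((P.testZ i, P.testX i, P.testZ iB, P.testX iB), P, ξ))
          (P.info i) *ᵥ 𝒜.eveVec P.bases i iB else 0‖ ≤
      4 * 2 ^ (n + nz + nx) * (Fintype.card (Partition n nz nx) *
        Real.exp (-((nx : ℝ) / (n + nx)) ^ 2 * n * ε ^ 2)) := by
  have hP : ∀ P : Partition n nz nx, ‖∑ i, ∑ iB, if P.TestPassed pz px i iB then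
      star (𝒜.eveVec P.bases i iB) ⬝ᵥ
        K.keyDefect (fun κ ξ => B κ ((P.testZ i, P.testX i, P.testZ iB, P.testX iB), P, ξ))
          (P.info i) *ᵥ 𝒜.eveVec P.bases i iB else 0‖ ≤
      4 * 2 ^ (n + nz + nx) * √(highProb 𝒜 P K.dist * passProb 𝒜 P px) := fun P => by
    let T : Bits nz → Bits nx → Bits nz → Bits nx → Prop := fun t u t' u' =>
      (hammingNorm (t + t') : ℝ) / nz ≤ pz ∧ (hammingNorm (u + u') : ℝ) / nx ≤ px
    let D : Bits nz → Bits nx → Bits nz → Bits nx → Bits n → Bits n → ℂ := fun t u t' u' x y =>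
      star (𝒜.eveVec P.bases (P.join x t u) (P.join y t' u')) ⬝ᵥ
        K.keyDefect (fun κ ξ => B κ ((t, u, t', u'), P, ξ)) x *ᵥ
          𝒜.eveVec P.bases (P.join x t u) (P.join y t' u')
    have h1 : (∑ i, ∑ iB, if P.TestPassed pz px i iB then
        star (𝒜.eveVec P.bases i iB) ⬝ᵥ
          K.keyDefect (fun κ ξ => B κ ((P.testZ i, P.testX i, P.testZ iB, P.testX iB), P, ξ))
            (P.info i) *ᵥ 𝒜.eveVec P.bases i iB else 0) =
        ∑ t, ∑ u, ∑ t', ∑ u', if T t u t' u' then ∑ x, ∑ y, D t u t' u' x y else 0 := by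
      rw [P.sum_join]
      simp_rw [P.sum_join (fun iB => ite (P.TestPassed pz px _ iB) _ _), Partition.TestPassed,
        Partition.testZ_add, Partition.testX_add, Partition.testZ_join, Partition.testX_join,
        Partition.info_join]
      rw [Finset.sum_comm]
      refine Finset.sum_congr rfl fun t _ => ?_
      rw [Finset.sum_comm]
      refine Finset.sum_congr rfl fun u _ => ?_
      have h2 : ∀ x : Bits n, ∑ y, ∑ t', ∑ u', (if T t u t' u' then D t u t' u' x y else 0) =
          ∑ t', ∑ u', ∑ y, (if T t u t' u' then D t u t' u' x y else 0) := fun x => by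
        rw [Finset.sum_comm]
        exact Finset.sum_congr rfl fun t' _ => Finset.sum_comm
      refine (Finset.sum_congr rfl fun x _ => h2 x).trans ?_
      rw [Finset.sum_comm]
      refine Finset.sum_congr rfl fun t' _ => ?_
      rw [Finset.sum_comm]
      refine Finset.sum_congr rfl fun u' _ => ?_
      split_ifs <;> simp
    rw [h1]
    have h3 : ‖∑ t, ∑ u, ∑ t', ∑ u', if T t u t' u' then ∑ x, ∑ y, D t u t' u' x y else 0‖ ≤
        ∑ t, ∑ u, ∑ t', ∑ u', (4 * 2 ^ n * √(highProb 𝒜 P K.dist)) *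
          if T t u t' u' then testProb 𝒜 P t t' u u' else 0 := by
      refine norm_sum_le_of_le _ fun t _ => norm_sum_le_of_le _ fun u _ =>
        norm_sum_le_of_le _ fun t' _ => norm_sum_le_of_le _ fun u' _ => ?_
      split_ifs with h
      · refine (norm_sum_info_le 𝒜 P hK (fun κ ξ => hB κ _) t t' u u').trans (le_of_eq ?_)
        ring
      · simp
    refine h3.trans ?_
    simp_rw [← Finset.mul_sum]
    refine (mul_le_mul_of_nonneg_left (sum_testProb_le 𝒜 P pz px) (by positivity)).trans ?_
    have h0 := passProb_nonneg 𝒜 P px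
    -- This weakening, valid for a probability, brings both factors under one root, as a joint
    -- probability.
    have h4 : passProb 𝒜 P px ≤ √(passProb 𝒜 P px) :=
      Real.le_sqrt_of_sq_le (by nlinarith [passProb_le_one 𝒜 P px])
    rw [Real.sqrt_mul (highProb_nonneg _ _ _), pow_add, pow_add]
    calc _ = 4 * (2 ^ n * 2 ^ nz * 2 ^ nx) * √(highProb 𝒜 P K.dist) * passProb 𝒜 P px := by ring
      _ ≤ 4 * (2 ^ n * 2 ^ nz * 2 ^ nx) * √(highProb 𝒜 P K.dist) * √(passProb 𝒜 P px) :=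
        mul_le_mul_of_nonneg_left h4 (by positivity)
      _ = _ := by ring
  refine (norm_sum_le_of_le _ fun P _ => hP P).trans ?_
  rw [← Finset.mul_sum]
  refine mul_le_mul_of_nonneg_left ?_ (by positivity)
  have hnn : ∀ P : Partition n nz nx, 0 ≤ highProb 𝒜 P K.dist * passProb 𝒜 P px := fun P =>
    mul_nonneg (highProb_nonneg _ _ _) (passProb_nonneg _ _ _)
  -- Cauchy–Schwarz over the partitions moves the average inside the root; the root turns the
  -- exponent factor `-2` into `-1`.
  have hcs := Real.sum_mul_le_sqrt_mul_sqrt (Finset.univ (α := Partition n nz nx)) (fun _ => 1)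
    fun P => √(highProb 𝒜 P K.dist * passProb 𝒜 P px)
  simp_rw [Real.sq_sqrt (hnn _), one_mul, one_pow] at hcs
  refine hcs.trans ?_
  refine (mul_le_mul_of_nonneg_left (Real.sqrt_le_sqrt
    (sum_highProb_mul_passProb_le 𝒜 hn hnx hε hd)) (Real.sqrt_nonneg _)).trans (le_of_eq ?_)
  rw [Finset.sum_const, nsmul_eq_mul, mul_one, Finset.card_univ, Real.sqrt_mul (by positivity),
    ← mul_assoc, Real.mul_self_sqrt (by positivity), ← Real.exp_half]
  congr 2
  ring

open scoped Classical in
/-- Reliability: the probability that the test is passed and the keys differ is small. -/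
theorem sum_keys_ne_le {n nz nx : ℕ} (𝒜 : CollectiveAttack (n + nz + nx)) {K : Code n}
    (hn : 0 < n) (hnz : 0 < nz) {pz px ε : ℝ} (hε : 0 ≤ ε)
    (hcorr : K.CorrectsErrors (n * (pz + ε))) :
    (∑ P : Partition n nz nx, ∑ i, ∑ iB, if P.TestPassed pz px i iB ∧
      K.bobKey (P.info iB) (K.syndrome (P.info i)) ≠ K.key (P.info i) then
        𝒜.outcomeProb P.bases i iB else 0) ≤
      2 ^ (n + nz + nx) * (Fintype.card (Partition n nz nx) *
        Real.exp (-2 * ((nz : ℝ) / (n + nz)) ^ 2 * n * ε ^ 2)) := by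
  have hnz' : (0 : ℝ) < nz := by exact_mod_cast hnz
  have hnn : ∀ b i iB, 0 ≤ 𝒜.outcomeProb b i iB := fun b i iB => nsq_nonneg _
  set X := Real.exp (-2 * ((nz : ℝ) / (n + nz)) ^ 2 * n * ε ^ 2)
  calc _ ≤ ∑ P : Partition n nz nx, ∑ i, ∑ iB,
        if n * (pz + ε) ≤ (hammingNorm (P.info (i + iB)) : ℝ) ∧
          (hammingNorm (P.testZ (i + iB)) : ℝ) ≤ nz * pz
        then 𝒜.outcomeProb P.bases i iB else 0 := by
        refine Finset.sum_le_sum fun P _ => Finset.sum_le_sum fun i _ =>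
          Finset.sum_le_sum fun iB _ => ?_
        by_cases h : P.TestPassed pz px i iB ∧
            K.bobKey (P.info iB) (K.syndrome (P.info i)) ≠ K.key (P.info i)
        · rw [if_pos h, if_pos]
          refine ⟨?_, ?_⟩
          · by_contra hlt
            refine h.2 (congrArg K.key (hcorr _ _ ?_))
            rw [hammingDist_eq_hammingNorm, ZModModule.neg_eq_self, ← Partition.info_add]
            exact (not_le.mp hlt).le
          · have := h.1.1
            rwa [div_le_iff₀ hnz', mul_comm] at this
        · rw [if_neg h]
          split_ifs
          · exact hnn _ _ _
          · exact le_rfl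
    -- Runs are grouped by the bases `b`: the outcome probabilities depend on the partition only
    -- through `b`.
    _ = ∑ b, ∑ i, ∑ iB, ∑ P : Partition n nz nx, if P.bases = b ∧
          n * (pz + ε) ≤ (hammingNorm (P.info (i + iB)) : ℝ) ∧
          (hammingNorm (P.testZ (i + iB)) : ℝ) ≤ nz * pz
        then 𝒜.outcomeProb b i iB else 0 := by
        have : ∀ (P : Partition n nz nx) i iB,
            (if n * (pz + ε) ≤ (hammingNorm (P.info (i + iB)) : ℝ) ∧
              (hammingNorm (P.testZ (i + iB)) : ℝ) ≤ nz * pz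
              then 𝒜.outcomeProb P.bases i iB else 0) =
            ∑ b, if P.bases = b ∧ n * (pz + ε) ≤ (hammingNorm (P.info (i + iB)) : ℝ) ∧
              (hammingNorm (P.testZ (i + iB)) : ℝ) ≤ nz * pz
              then 𝒜.outcomeProb b i iB else 0 := fun P i iB => by
          simp_rw [ite_and (P.bases = _)]
          rw [Finset.sum_ite_eq, if_pos (Finset.mem_univ _)]
        simp_rw [this]
        exact sum_comm_outer_inner _
    _ ≤ ∑ b, ∑ i, ∑ iB, (Finset.univ.filter fun P : Partition n nz nx => P.bases = b).card * X *
          𝒜.outcomeProb b i iB := by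
        refine Finset.sum_le_sum fun b _ => Finset.sum_le_sum fun i _ =>
          Finset.sum_le_sum fun iB _ => ?_
        rw [← Finset.sum_filter, Finset.sum_const, nsmul_eq_mul]
        exact mul_le_mul_of_nonneg_right (card_bad_testZ_le hn (p := pz) hε b (i + iB)) (hnn _ _ _)
    _ = _ := by
        simp_rw [← Finset.mul_sum, CollectiveAttack.sum_outcomeProb]
        have hcard : ∑ b, ((Finset.univ.filter
            fun P : Partition n nz nx => P.bases = b).card : ℝ) =
            Fintype.card (Partition n nz nx) := by
          rw [← Nat.cast_sum, ← Finset.card_eq_sum_card_fiberwise (by simp [Set.MapsTo]),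
            Finset.card_univ]
        rw [← Finset.sum_mul, ← Finset.sum_mul, hcard]
        simp [ZMod.card]
        ring

/-! ### The final state -/

section
variable {α F Ω : Type*}

/-- The vector `|a⟩ ⊗ v ⊗ |w⟩`. -/
def runVec [DecidableEq α] [DecidableEq Ω] (a : α) (w : Ω) (v : F → ℂ) : α × (F × Ω) → ℂ :=
  fun q => if q.1 = a ∧ q.2.2 = w then v q.2.1 else 0

theorem sum_runVec_support [Fintype α] [Fintype F] [Fintype Ω] {M : Type*}
    [AddCommMonoid M] (a : α) (w : Ω) (f : α × (F × Ω) → M)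
    (hf : ∀ q, ¬ (q.1 = a ∧ q.2.2 = w) → f q = 0) : ∑ q, f q = ∑ e, f (a, (e, w)) := by
  rw [Fintype.sum_prod_type, Finset.sum_eq_single a
    (fun b _ hb => Finset.sum_eq_zero fun q _ => hf _ fun h => hb h.1) (by simp),
    Fintype.sum_prod_type]
  exact Finset.sum_congr rfl fun e _ =>
    Finset.sum_eq_single w (fun w' _ hw => hf _ fun h => hw h.2) (by simp)

theorem nsq_runVec [Fintype α] [Fintype F] [Fintype Ω] [DecidableEq α] [DecidableEq Ω]
    (a : α) (w : Ω) (v : F → ℂ) : nsq (runVec a w v) = nsq v := by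
  rw [nsq, sum_runVec_support a w _ fun q hq => by simp [runVec, hq]]
  simp [runVec, nsq]

/-- The diagonal block of a matrix at given classical data. -/
def block (S : Matrix (α × (F × Ω)) (α × (F × Ω)) ℂ) (a : α) (w : Ω) : Matrix F F ℂ :=
  S.submatrix (fun e => (a, (e, w))) fun e => (a, (e, w))

theorem dotProduct_runVec [Fintype α] [Fintype F] [Fintype Ω] [DecidableEq α] [DecidableEq Ω]
    (S : Matrix (α × (F × Ω)) (α × (F × Ω)) ℂ) (a : α) (w : Ω) (u v : F → ℂ) :
    star (runVec a w u) ⬝ᵥ S *ᵥ runVec a w v = star u ⬝ᵥ block S a w *ᵥ v := by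
  rw [dotProduct, sum_runVec_support a w _ fun q hq => by simp [runVec, hq]]
  refine Finset.sum_congr rfl fun e _ => ?_
  rw [Matrix.mulVec, dotProduct, sum_runVec_support a w _ fun q hq => by simp [runVec, hq]]
  simp [runVec, block, Matrix.mulVec, dotProduct]

/-- A block of an isometry is a contraction: embed `u` and `v` at the given classical data. -/
theorem norm_block_le [Fintype α] [Fintype F] [Fintype Ω] [DecidableEq α] [DecidableEq F]
    [DecidableEq Ω] {S : Matrix (α × (F × Ω)) (α × (F × Ω)) ℂ} (hS : Sᴴ * S = 1) (a : α) (w : Ω)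
    (u v : F → ℂ) : ‖star u ⬝ᵥ block S a w *ᵥ v‖ ≤ √(nsq u) * √(nsq v) := by
  have := norm_form_le hS (runVec a w u) (runVec a w v)
  rwa [dotProduct_runVec, nsq_runVec, nsq_runVec] at this

theorem proj_kronecker_vecMulVec [DecidableEq α] [DecidableEq Ω] (a : α) (w : Ω) (v : F → ℂ) :
    proj a ⊗ₖ (Matrix.vecMulVec v (star v) ⊗ₖ proj w) =
      Matrix.vecMulVec (runVec a w v) (star (runVec a w v)) := by
  ext ⟨a₁, e₁, w₁⟩ ⟨a₂, e₂, w₂⟩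
  simp only [Matrix.kroneckerMap_apply, proj, Matrix.single_apply, Matrix.vecMulVec_apply, runVec,
    Pi.star_apply]
  by_cases h1 : a₁ = a <;> by_cases h2 : a₂ = a <;> by_cases h3 : w₁ = w <;>
    by_cases h4 : w₂ = w <;> simp [h1, h2, h3, h4, eq_comm (a := a), eq_comm (a := w)]

theorem proj_kronecker_proj {β : Type*} [DecidableEq α] [DecidableEq β] (a : α) (b : β) :
    proj a ⊗ₖ proj b = proj (a, b) := by
  simp [proj, Matrix.single_kronecker_single]

theorem partialTraceLeft_kronecker [Fintype α] (X : Matrix α α ℂ) (Y : Matrix F F ℂ) :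
    partialTraceLeft (X ⊗ₖ Y) = X.trace • Y := by
  ext e e'
  simp [partialTraceLeft, Matrix.trace, Finset.sum_mul]

end

section
variable {n : ℕ} (K : Code n) (nz nx : ℕ) (pz px : ℝ) (𝒜 : CollectiveAttack (n + nz + nx))

/-- The probability of a partition together with a string sent by Alice. -/
def runWeight (n nz nx : ℕ) : ℝ :=
  (1 / (Fintype.card (Partition n nz nx) : ℝ)) * (1 / 2 ^ (n + nz + nx))

theorem runWeight_nonneg (n nz nx : ℕ) : 0 ≤ runWeight n nz nx := by
  unfold runWeight; positivity

/-- The outcome probability cancels the normalization of the state. At probability `0` the vector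
itself vanishes, so the default value of `eveState` does no harm. -/
theorem jointProb_smul_eveState (i iB : Bits (n + nz + nx)) (P : Partition n nz nx) :
    (jointProb nz nx 𝒜 i iB P : ℂ) • 𝒜.eveState P.bases i iB =
      (runWeight n nz nx : ℂ) • Matrix.vecMulVec (𝒜.eveVec P.bases i iB)
        (star (𝒜.eveVec P.bases i iB)) := by
  have hj : jointProb nz nx 𝒜 i iB P = runWeight n nz nx * 𝒜.outcomeProb P.bases i iB := rfl
  rw [CollectiveAttack.eveState, smul_smul, hj]
  by_cases h : 𝒜.outcomeProb P.bases i iB = 0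
  · have hv : 𝒜.eveVec P.bases i iB = 0 := by
      funext e
      have := (Finset.sum_eq_zero_iff_of_nonneg fun e _ => by positivity).mp h e (Finset.mem_univ e)
      simpa using this
    simp [hv]
  · have h' : (𝒜.outcomeProb P.bases i iB : ℂ) ≠ 0 := by exact_mod_cast h
    rw [Complex.ofReal_mul, mul_assoc, mul_inv_cancel₀ h', mul_one]

/-- The rank one operator of a run with given final keys. -/
def runOp (κ κ' : Bits K.m) (P : Partition n nz nx) (i iB : Bits (n + nz + nx)) :
    Matrix ((Bits K.m × Bits K.m) × (𝒜.Probe × Public K nz nx))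
      ((Bits K.m × Bits K.m) × (𝒜.Probe × Public K nz nx)) ℂ :=
  Matrix.vecMulVec (runVec (κ, κ') (published K nz nx P i iB) (𝒜.eveVec P.bases i iB))
    (star (runVec (κ, κ') (published K nz nx P i iB) (𝒜.eveVec P.bases i iB)))

open scoped Classical in
theorem rhoABE_eq : rhoABE K nz nx pz px 𝒜 =
    ∑ P : Partition n nz nx, ∑ i, ∑ iB, if P.TestPassed pz px i iB then
      (runWeight n nz nx : ℂ) • runOp K nz nx 𝒜 (K.key (P.info i))
        (K.bobKey (P.info iB) (K.syndrome (P.info i))) P i iB else 0 := by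
  rw [rhoABE]
  refine Finset.sum_congr rfl fun P _ => Finset.sum_congr rfl fun i _ =>
    Finset.sum_congr rfl fun iB _ => ?_
  split_ifs
  · rw [← Matrix.kronecker_smul, ← Matrix.smul_kronecker, jointProb_smul_eveState,
      Matrix.smul_kronecker, Matrix.kronecker_smul, proj_kronecker_proj, proj_kronecker_vecMulVec]
    rfl
  · rfl

open scoped Classical in
-- Tracing out the keys keeps Eve's vector and the published data of each run, so the ideal state is
-- a sum over the same runs as `rhoABE`, and the two can be compared term by term.
theorem rhoU_kronecker_rhoE : rhoU K ⊗ₖ rhoE K nz nx pz px 𝒜 =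
    ∑ P : Partition n nz nx, ∑ i, ∑ iB, if P.TestPassed pz px i iB then
      (runWeight n nz nx : ℂ) • ((1 / 2 ^ K.m : ℂ) • ∑ κ, runOp K nz nx 𝒜 κ κ P i iB) else 0 := by
  have hE : rhoE K nz nx pz px 𝒜 =
      ∑ P : Partition n nz nx, ∑ i, ∑ iB, if P.TestPassed pz px i iB then
      (runWeight n nz nx : ℂ) • (Matrix.vecMulVec (𝒜.eveVec P.bases i iB)
        (star (𝒜.eveVec P.bases i iB)) ⊗ₖ proj (published K nz nx P i iB)) else 0 := by
    let L : Matrix ((Bits K.m × Bits K.m) × (𝒜.Probe × Public K nz nx))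
        ((Bits K.m × Bits K.m) × (𝒜.Probe × Public K nz nx)) ℂ →+
        Matrix (𝒜.Probe × Public K nz nx) (𝒜.Probe × Public K nz nx) ℂ :=
      { toFun := partialTraceLeft
        map_zero' := by ext; simp [partialTraceLeft]
        map_add' := fun X Y => by ext; simp [partialTraceLeft, Finset.sum_add_distrib] }
    change L (rhoABE K nz nx pz px 𝒜) = _
    rw [rhoABE, map_sum]
    refine Finset.sum_congr rfl fun P _ => ?_
    rw [map_sum]
    refine Finset.sum_congr rfl fun i _ => ?_
    rw [map_sum]
    refine Finset.sum_congr rfl fun iB _ => ?_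
    split_ifs
    · rw [← Matrix.kronecker_smul, ← Matrix.smul_kronecker, jointProb_smul_eveState,
        Matrix.smul_kronecker]
      change partialTraceLeft _ = _
      rw [partialTraceLeft_kronecker, proj_kronecker_proj, proj, Matrix.trace_single_eq_same,
        one_smul]
    · exact map_zero L
  have hU : ∀ Y : Matrix (𝒜.Probe × Public K nz nx) (𝒜.Probe × Public K nz nx) ℂ,
      rhoU K ⊗ₖ Y = (1 / 2 ^ K.m : ℂ) • ∑ κ : Bits K.m, proj (κ, κ) ⊗ₖ Y := fun Y => by
    rw [rhoU, Matrix.smul_kronecker]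
    simp_rw [proj_kronecker_proj]
    congr 1
    ext q q'
    simp [Matrix.kroneckerMap_apply, Matrix.sum_apply, Finset.sum_mul]
  let R : Matrix (𝒜.Probe × Public K nz nx) (𝒜.Probe × Public K nz nx) ℂ →+
      Matrix ((Bits K.m × Bits K.m) × (𝒜.Probe × Public K nz nx))
        ((Bits K.m × Bits K.m) × (𝒜.Probe × Public K nz nx)) ℂ :=
    { toFun := fun Y => rhoU K ⊗ₖ Y
      map_zero' := Matrix.kronecker_zero _
      map_add' := fun X Y => Matrix.kronecker_add _ _ _ }
  change R (rhoE K nz nx pz px 𝒜) = _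
  rw [hE, map_sum]
  refine Finset.sum_congr rfl fun P _ => ?_
  rw [map_sum]
  refine Finset.sum_congr rfl fun i _ => ?_
  rw [map_sum]
  refine Finset.sum_congr rfl fun iB _ => ?_
  split_ifs
  · change rhoU K ⊗ₖ _ = _
    rw [Matrix.kronecker_smul, hU]
    simp_rw [proj_kronecker_vecMulVec]
    rfl
  · exact map_zero R

theorem runOp_isHermitian (κ κ' : Bits K.m) (P : Partition n nz nx)
    (i iB : Bits (n + nz + nx)) : (runOp K nz nx 𝒜 κ κ' P i iB).IsHermitian := by
  rw [Matrix.IsHermitian, runOp, Matrix.conjTranspose_vecMulVec, star_star]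

theorem rhoABE_sub_isHermitian :
    (rhoABE K nz nx pz px 𝒜 - rhoU K ⊗ₖ rhoE K nz nx pz px 𝒜).IsHermitian := by
  have h := fun κ κ' P i iB => (runOp_isHermitian K nz nx 𝒜 κ κ' P i iB).eq
  refine Matrix.IsHermitian.sub ?_ ?_
  · rw [rhoABE_eq, Matrix.IsHermitian]
    simp only [Matrix.conjTranspose_sum, apply_ite Matrix.conjTranspose, Matrix.conjTranspose_smul,
      Matrix.conjTranspose_zero, h, Complex.star_def, Complex.conj_ofReal]
  · rw [rhoU_kronecker_rhoE, Matrix.IsHermitian]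
    simp only [Matrix.conjTranspose_sum, apply_ite Matrix.conjTranspose, Matrix.conjTranspose_smul,
      Matrix.conjTranspose_zero, h, Complex.star_def, Complex.conj_ofReal, map_div₀, map_one,
      map_pow, Complex.conj_ofNat]

theorem trace_mul_runOp (S : Matrix ((Bits K.m × Bits K.m) × (𝒜.Probe × Public K nz nx))
      ((Bits K.m × Bits K.m) × (𝒜.Probe × Public K nz nx)) ℂ) (κ κ' : Bits K.m)
    (P : Partition n nz nx) (i iB : Bits (n + nz + nx)) :
    (S * runOp K nz nx 𝒜 κ κ' P i iB).trace = star (𝒜.eveVec P.bases i iB) ⬝ᵥ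
      block S (κ, κ') (published K nz nx P i iB) *ᵥ 𝒜.eveVec P.bases i iB := by
  rw [runOp, trace_mul_vecMulVec_star, dotProduct_runVec]

end

open scoped Classical in
/-- The distance from the ideal state is at most the sum of the failure probabilities of
reliability and of secrecy. -/
theorem distanceFromIdeal_le {n nz nx : ℕ} {K : Code n} (𝒜 : CollectiveAttack (n + nz + nx))
    (hK : LinearIndependent (ZMod 2) K.rows) (hn : 0 < n) (hnz : 0 < nz) (hnx : 0 < nx)
    {pz px εrel εsec : ℝ} (hεrel : 0 ≤ εrel) (hεsec : 0 ≤ εsec)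
    (hcorr : K.CorrectsErrors (n * (pz + εrel))) (hd : n * (px + εsec) ≤ K.dist / 2) :
    distanceFromIdeal K nz nx pz px 𝒜 ≤
      Real.exp (-2 * ((nz : ℝ) / (n + nz)) ^ 2 * n * εrel ^ 2) +
        2 * Real.exp (-((nx : ℝ) / (n + nx)) ^ 2 * n * εsec ^ 2) := by
  obtain ⟨S, hS, habs⟩ := exists_sign (rhoABE_sub_isHermitian K nz nx pz px 𝒜)
  set X := Real.exp (-2 * ((nz : ℝ) / (n + nz)) ^ 2 * n * εrel ^ 2)
  set Y := Real.exp (-((nx : ℝ) / (n + nx)) ^ 2 * n * εsec ^ 2)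
  let β : Bits K.m → Bits K.m → Partition n nz nx → Bits (n + nz + nx) → Bits (n + nz + nx) → ℂ :=
    fun κ κ' P i iB => star (𝒜.eveVec P.bases i iB) ⬝ᵥ
      block S (κ, κ') (published K nz nx P i iB) *ᵥ 𝒜.eveVec P.bases i iB
  have hβ : ∀ κ κ' P i iB, ‖β κ κ' P i iB‖ ≤ 𝒜.outcomeProb P.bases i iB := fun κ κ' P i iB => by
    refine (norm_block_le hS _ _ _ _).trans (le_of_eq ?_)
    rw [Real.mul_self_sqrt (nsq_nonneg _)]
    rfl
  -- The intermediate term has Alice's key on both sides: `rel` replaces Bob's key by Alice's, `sec`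
  -- replaces the common key by the uniform average.
  let rel : ℂ := ∑ P : Partition n nz nx, ∑ i, ∑ iB, if P.TestPassed pz px i iB then
    β (K.key (P.info i)) (K.bobKey (P.info iB) (K.syndrome (P.info i))) P i iB -
      β (K.key (P.info i)) (K.key (P.info i)) P i iB else 0
  let sec : ℂ := ∑ P : Partition n nz nx, ∑ i, ∑ iB, if P.TestPassed pz px i iB then
    star (𝒜.eveVec P.bases i iB) ⬝ᵥ K.keyDefect (fun κ ξ => block S (κ, κ)
      ((P.testZ i, P.testX i, P.testZ iB, P.testX iB), P, ξ)) (P.info i) *ᵥ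
        𝒜.eveVec P.bases i iB else 0
  have htrace : (S * (rhoABE K nz nx pz px 𝒜 - rhoU K ⊗ₖ rhoE K nz nx pz px 𝒜)).trace =
      (runWeight n nz nx : ℂ) * (rel + sec) := by
    rw [rhoABE_eq, rhoU_kronecker_rhoE]
    simp only [rel, sec, ← Finset.sum_sub_distrib, ← Finset.sum_add_distrib, Finset.mul_sum,
      Matrix.trace_sum]
    refine Finset.sum_congr rfl fun P _ => Finset.sum_congr rfl fun i _ =>
      Finset.sum_congr rfl fun iB _ => ?_
    split_ifs
    · rw [← smul_sub, mul_smul_comm, Matrix.trace_smul, smul_eq_mul, mul_sub, Matrix.trace_sub,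
        mul_smul_comm, Matrix.trace_smul, Finset.mul_sum, Matrix.trace_sum, trace_mul_runOp,
        Code.dotProduct_keyDefect]
      simp_rw [trace_mul_runOp]
      rw [smul_eq_mul]
      exact congrArg _ (sub_add_sub_cancel _
        (β (K.key (P.info i)) (K.key (P.info i)) P i iB) _).symm
    · simp
  have hsec : ‖sec‖ ≤ 4 * 2 ^ (n + nz + nx) * (Fintype.card (Partition n nz nx) * Y) :=
    norm_sum_runs_keyDefect_le 𝒜 hK hn hnx hεsec hd (fun κ w => block S (κ, κ) w)
      fun κ w => norm_block_le hS _ _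
  have hrel : ‖rel‖ ≤ 2 * (2 ^ (n + nz + nx) * (Fintype.card (Partition n nz nx) * X)) := by
    refine le_trans ?_ (mul_le_mul_of_nonneg_left
      (sum_keys_ne_le (px := px) 𝒜 hn hnz hεrel hcorr) (by norm_num))
    simp only [Finset.mul_sum]
    refine norm_sum_le_of_le _ fun P _ => norm_sum_le_of_le _ fun i _ =>
      norm_sum_le_of_le _ fun iB _ => ?_
    by_cases hT : P.TestPassed pz px i iB
    · by_cases hk : K.bobKey (P.info iB) (K.syndrome (P.info i)) = K.key (P.info i)
      · simp [hk]
      · rw [if_pos hT, if_pos ⟨hT, hk⟩, two_mul]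
        exact (norm_sub_le _ _).trans (add_le_add (hβ _ _ _ _ _) (hβ _ _ _ _ _))
    · simp [hT]
  -- An inequality suffices, and it also covers an empty type of partitions, where division by zero
  -- makes the weight `0`.
  have hw : runWeight n nz nx * (2 ^ (n + nz + nx) * Fintype.card (Partition n nz nx)) ≤ 1 := by
    rw [runWeight]
    rcases eq_or_ne (Fintype.card (Partition n nz nx) : ℝ) 0 with h | h
    · rw [h]; simp
    · field_simp; rfl
  rw [distanceFromIdeal, traceDist, habs, htrace]
  have h1 : ((runWeight n nz nx : ℂ) * (rel + sec)).re ≤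
      runWeight n nz nx * (2 ^ (n + nz + nx) * Fintype.card (Partition n nz nx)) *
        (2 * X + 4 * Y) := by
    refine (Complex.re_le_norm _).trans ?_
    rw [norm_mul, Complex.norm_real, Real.norm_of_nonneg (runWeight_nonneg _ _ _), mul_assoc]
    refine mul_le_mul_of_nonneg_left ((norm_add_le _ _).trans ((add_le_add hrel hsec).trans
      (le_of_eq ?_))) (runWeight_nonneg _ _ _)
    ring
  have hX : 0 < X := Real.exp_pos _
  have hY : 0 < Y := Real.exp_pos _
  have h2 := h1.trans (mul_le_mul_of_nonneg_right hw (by positivity))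
  linarith

/-- The security bound decays exponentially when the numbers of test bits are proportional to the
number of INFO bits. -/
theorem exists_exponential_bound {R εrel εsec c : ℝ} (hR : 0 < R) (hεrel : 0 < εrel)
    (hεsec : 0 < εsec) (hc : 0 < c) :
    ∃ C κ : ℝ, 0 < C ∧ 0 < κ ∧
      ∀ n nz nx : ℕ, 0 < n → 0 < nz → 0 < nx → c * n ≤ nz → c * n ≤ nx →
        Real.exp (-2 * ((nz : ℝ) / (n + nz)) ^ 2 * n * εrel ^ 2) +
            2 * R * n * Real.exp (-((nx : ℝ) / (n + nx)) ^ 2 * n * εsec ^ 2) ≤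
          C * Real.exp (-κ * n) := by
  set g : ℝ := c / (1 + c) with hg
  have hg0 : 0 < g := by positivity
  set a : ℝ := 2 * g ^ 2 * εrel ^ 2 with ha
  set b : ℝ := g ^ 2 * εsec ^ 2 with hb
  have ha0 : 0 < a := by positivity
  have hb0 : 0 < b := by positivity
  have hfrac : ∀ n k : ℕ, 0 < n → c * n ≤ k → g ^ 2 ≤ ((k : ℝ) / (n + k)) ^ 2 := fun n k hn hk => by
    have hn' : (0 : ℝ) < n := by exact_mod_cast hn
    refine pow_le_pow_left₀ hg0.le ?_ 2
    rw [hg, div_le_div_iff₀ (by positivity) (by positivity)]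
    nlinarith
  -- Half of the rate `b` is spent on absorbing the factor `n`, by `b / 2 * n ≤ exp (b / 2 * n)`;
  -- hence `4 * R / b = 2 * R / (b / 2)`.
  refine ⟨1 + 4 * R / b, min a (b / 2), by positivity, by positivity, ?_⟩
  intro n nz nx hn _ _ hz hx
  have hn' : (0 : ℝ) < n := by exact_mod_cast hn
  have h1 : Real.exp (-2 * ((nz : ℝ) / (n + nz)) ^ 2 * n * εrel ^ 2) ≤
      Real.exp (-min a (b / 2) * n) := by
    refine Real.exp_le_exp.mpr ?_
    have e1 : min a (b / 2) * n ≤ a * n := mul_le_mul_of_nonneg_right (min_le_left _ _) hn'.le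
    have e2 := mul_le_mul_of_nonneg_right (hfrac n nz hn hz)
      (by positivity : (0 : ℝ) ≤ n * εrel ^ 2)
    rw [ha] at e1
    linarith
  have h2 : Real.exp (-((nx : ℝ) / (n + nx)) ^ 2 * n * εsec ^ 2) ≤ Real.exp (-(b * n)) := by
    refine Real.exp_le_exp.mpr ?_
    have e2 := mul_le_mul_of_nonneg_right (hfrac n nx hn hx)
      (by positivity : (0 : ℝ) ≤ n * εsec ^ 2)
    rw [hb]
    linarith
  have h3 : b / 2 * n * Real.exp (-(b * n)) ≤ Real.exp (-min a (b / 2) * n) := by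
    have e1 : b / 2 * n ≤ Real.exp (b / 2 * n) := by
      have := Real.add_one_le_exp (b / 2 * n)
      linarith
    refine (mul_le_mul_of_nonneg_right e1 (Real.exp_pos _).le).trans ?_
    rw [← Real.exp_add]
    refine Real.exp_le_exp.mpr ?_
    have e2 : min a (b / 2) * n ≤ b / 2 * n := mul_le_mul_of_nonneg_right (min_le_right _ _) hn'.le
    linarith
  have h4 : 2 * R * n * Real.exp (-((nx : ℝ) / (n + nx)) ^ 2 * n * εsec ^ 2) ≤
      4 * R / b * Real.exp (-min a (b / 2) * n) := by
    refine (mul_le_mul_of_nonneg_left h2 (by positivity)).trans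
      (le_trans (le_of_eq ?_) (mul_le_mul_of_nonneg_left h3 (by positivity : 0 ≤ 4 * R / b)))
    field_simp
    ring
  linarith

end BB84InfoZ
end

/-! ### The security theorem -/

theorem mainTheorem1
    (δ R : ℝ) (hδ : 0 < δ) (hR : 0 < R)
    (S : Set ℕ) (K : ∀ n : ℕ, BB84InfoZ.Code n)
    (hindep : ∀ n ∈ S, LinearIndependent (ZMod 2) (K n).rows)
    (hdist : ∀ n ∈ S, δ < ((K n).dist : ℝ) / n)
    (hrate : ∀ n ∈ S, ((K n).m : ℝ) / n ≤ R)
    (pz px εsec εrel : ℝ) (hpz : 0 < pz) (hpx : 0 < px) (hεsec : 0 < εsec) (hεrel : 0 < εrel)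
    (hpx_le : px + εsec ≤ δ / 2)
    (hcorr : ∀ n ∈ S, (K n).CorrectsErrors (n * (pz + εrel))) :
    (∀ n ∈ S, ∀ nz nx : ℕ, 0 < n → 0 < nz → 0 < nx →
      ∀ 𝒜 : BB84InfoZ.CollectiveAttack (n + nz + nx),
        BB84InfoZ.distanceFromIdeal (K n) nz nx pz px 𝒜 ≤
          Real.exp (-2 * ((nz : ℝ) / (n + nz)) ^ 2 * n * εrel ^ 2) +
            2 * R * n * Real.exp (-((nx : ℝ) / (n + nx)) ^ 2 * n * εsec ^ 2)) ∧
    (∀ c : ℝ, 0 < c → ∃ C κ : ℝ, 0 < C ∧ 0 < κ ∧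
      (∀ n nz nx : ℕ, 0 < n → 0 < nz → 0 < nx → c * n ≤ nz → c * n ≤ nx →
        Real.exp (-2 * ((nz : ℝ) / (n + nz)) ^ 2 * n * εrel ^ 2) +
            2 * R * n * Real.exp (-((nx : ℝ) / (n + nx)) ^ 2 * n * εsec ^ 2) ≤
          C * Real.exp (-κ * n)) ∧
      (∀ n ∈ S, ∀ nz nx : ℕ, 0 < n → 0 < nz → 0 < nx → c * n ≤ nz → c * n ≤ nx →
        ∀ 𝒜 : BB84InfoZ.CollectiveAttack (n + nz + nx),
          BB84InfoZ.distanceFromIdeal (K n) nz nx pz px 𝒜 ≤ C * Real.exp (-κ * n))) := by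
  have hmain : ∀ n ∈ S, ∀ nz nx : ℕ, 0 < n → 0 < nz → 0 < nx →
      ∀ 𝒜 : BB84InfoZ.CollectiveAttack (n + nz + nx),
        BB84InfoZ.distanceFromIdeal (K n) nz nx pz px 𝒜 ≤
          Real.exp (-2 * ((nz : ℝ) / (n + nz)) ^ 2 * n * εrel ^ 2) +
            2 * R * n * Real.exp (-((nx : ℝ) / (n + nx)) ^ 2 * n * εsec ^ 2) := by
    intro n hnS nz nx hn hnz hnx 𝒜
    have hn' : (0 : ℝ) < n := by exact_mod_cast hn
    have hdn : δ * n < (K n).dist := (lt_div_iff₀ hn').mp (hdist n hnS)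
    have hd : n * (px + εsec) ≤ ((K n).dist : ℝ) / 2 := by nlinarith
    -- For `m = 0` the distance takes the default value `0` of an empty infimum, contradicting `δ *
    -- n < dist`.
    have hm : 1 ≤ (K n).m := by
      by_contra hm
      have hm0 : (K n).m = 0 := by omega
      have h0 : (K n).dist = 0 := by
        rw [BB84InfoZ.Code.dist, Nat.sInf_eq_zero]
        refine Or.inr (Set.eq_empty_of_forall_notMem ?_)
        rintro d ⟨l, hl, -⟩
        have := l.2
        omega
      rw [h0, Nat.cast_zero] at hdn
      nlinarith
    -- The secrecy estimate has no factor `R * n`; it is inserted at no cost because `1 ≤ m ≤ R *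
    -- n`.
    have hRn : 1 ≤ R * n := by
      have h1 : ((K n).m : ℝ) ≤ R * n := (div_le_iff₀ hn').mp (hrate n hnS)
      have h2 : (1 : ℝ) ≤ (K n).m := by exact_mod_cast hm
      linarith
    refine (BB84InfoZ.distanceFromIdeal_le 𝒜 (hindep n hnS) hn hnz hnx hεrel.le hεsec.le
      (hcorr n hnS) hd).trans ?_
    have hY := Real.exp_pos (-((nx : ℝ) / (n + nx)) ^ 2 * n * εsec ^ 2)
    have := mul_le_mul_of_nonneg_right hRn hY.le
    linarith
  refine ⟨hmain, fun c hc => ?_⟩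
  obtain ⟨C, κ, hC, hκ, h⟩ := BB84InfoZ.exists_exponential_bound hR hεrel hεsec hc
  exact ⟨C, κ, hC, hκ, h, fun n hnS nz nx hn hnz hnx hz hx 𝒜 =>
    (hmain n hnS nz nx hn hnz hnx 𝒜).trans (h n nz nx hn hnz hnx hz hx)⟩
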